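/- Consider the following discrete-time rewire-to-random evolving voter model on simple graphs with vertex set $\{1,\dots,N\}$, each vertex having an opinion (state) $0$ or $1$. An edge is discordant if its endpoints have different states. At each update a discordant edge is chosen uniformly at random and given a uniformly random orientation $(v,u)$. With probability $\nu/L$ the vertex $v$ adopts the state of $u$; with probability $1-\nu/L$ the edge $\{v,u\}$ is replaced by $\{v,z\}$, where $z$ is uniform among the vertices that are neither $v$ nor neighbors of $v$ (if there is no such $z$, nothing changes). The process stops at the first time $\tau$ (number of updates) at which there are no discordant edges. Let $\mathcal G(p,N,L)$ be the set of labeled graphs with $N$ vertices, $pN$ of them in state $1$, and $NL/2$ edges. Theorem. Let $\nu>0$. There is $p(\nu)\in(0,1/2)$, depending only on $\nu$, such that the following holds for every $\epsilon>0$, every $a\in(0,1)$ and every $L=L(N)$ with $L(N)\sim N^a$. As $N\to\infty$, uniformly over all $p\le p(\nu)$ and all initial labeled graphs $G(0)\in\mathcal G(p,N,L)$, with probability tending to $1$ we have $\tau<7NL$ and the fraction of vertices in state $1$ at time $\tau$ lies in $(p-\epsilon,p+\epsilon)$. -/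

import Mathlib

open MeasureTheory ProbabilityTheory Filter

namespace EvolvingVoter

/-- A configuration: a simple graph on `N` vertices together with the opinion of each vertex
(`true` is opinion 1, `false` is opinion 0). -/
@[ext]
structure Config (N : ℕ) where
  graph : SimpleGraph (Fin N)
  opinion : Fin N → Bool

/-- Configurations form a finite set, which carries the discrete sigma-algebra. -/
instance (N : ℕ) : MeasurableSpace (Config N) := ⊤

namespace Config

variable {N : ℕ}

open Classical in
/-- The discordant edges, each one listed with both of its orientations `(v, u)`. -/
noncomputable def discordant (s : Config N) : Finset (Fin N × Fin N) :=
  Finset.univ.filter fun e => s.graph.Adj e.1 e.2 ∧ s.opinion e.1 ≠ s.opinion e.2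

/-- The fraction of vertices in state 1. -/
noncomputable def fractionOnes (s : Config N) : ℝ :=
  ({v | s.opinion v = true} : Set (Fin N)).ncard / (N : ℝ)

/-- Voting on the oriented edge `(v, u)`: `v` adopts the opinion of `u`. -/
def imitate (s : Config N) (v u : Fin N) : Config N where
  graph := s.graph
  opinion := Function.update s.opinion v (s.opinion u)

/-- The edge `{v, u}` is replaced by `{v, z}`. -/
def moveEdge (s : Config N) (v u z : Fin N) : Config N where
  graph := s.graph.deleteEdges {s(v, u)} ⊔ SimpleGraph.edge v z
  opinion := s.opinion

open Classical in
/-- The vertices to which `v` may rewire: those which are neither `v` nor a neighbour of `v`. -/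
noncomputable def targets (s : Config N) (v : Fin N) : Finset (Fin N) :=
  Finset.univ.filter fun z => z ≠ v ∧ ¬ s.graph.Adj v z

open Classical in
/-- Rewiring of the oriented edge `(v, u)`: `v` drops `u` and connects to a uniformly chosen
vertex among those which are neither `v` nor one of its neighbours. If there is no such vertex,
the edge stays where it is. -/
noncomputable def rewire (s : Config N) (v u : Fin N) : PMF (Config N) :=
  if h : (s.targets v).Nonempty then
    (PMF.uniformOfFinset (s.targets v) h).map (s.moveEdge v u)
  else PMF.pure s

end Config

/-- A coin which shows `true` with probability `q` (truncated to `[0, 1]`). -/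
noncomputable def coin (q : ℝ) : PMF Bool :=
  PMF.ofFintype
    (fun b => if b then ENNReal.ofReal (max 0 (min 1 q)) else ENNReal.ofReal (1 - max 0 (min 1 q)))
    (by
      have h1 : max 0 (min 1 q) ≤ 1 := max_le zero_le_one (min_le_left _ _)
      simp only [Fintype.sum_bool, if_true, Bool.false_eq_true, if_false]
      rw [← ENNReal.ofReal_add (le_max_left _ _) (by linarith)]
      simp)

open Classical in
/-- One update of the rewire-to-random dynamics (efficient version), with voting probability `q`.
A uniformly chosen discordant edge with a uniformly chosen orientation, that is, a uniformly chosen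
oriented discordant edge `(v, u)`, is updated: with probability `q` the vertex `v` imitates `u`,
otherwise `v` rewires. Nothing happens if there are no discordant edges. -/
noncomputable def step {N : ℕ} (q : ℝ) (s : Config N) : PMF (Config N) :=
  if h : s.discordant.Nonempty then
    (PMF.uniformOfFinset s.discordant h).bind fun e =>
      (coin q).bind fun vote =>
        if vote then PMF.pure (s.imitate e.1 e.2) else s.rewire e.1 e.2
  else PMF.pure s

/-- The transition from the history up to time `n` to time `n + 1`. It only uses the
configuration at time `n`. -/
noncomputable def transition (N : ℕ) (q : ℝ) (n : ℕ) :
    Kernel (Π _ : Finset.Iic n, Config N) (Config N) where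
  toFun x := (step q (x ⟨n, Finset.mem_Iic.2 le_rfl⟩)).toMeasure
  measurable' :=
    (measurable_from_top (f := fun s : Config N => (step q s).toMeasure)).comp
      (measurable_pi_apply _)

instance (N : ℕ) (q : ℝ) (n : ℕ) : IsMarkovKernel (transition N q n) :=
  ⟨fun _ => by unfold transition; exact PMF.toMeasure.isProbabilityMeasure _⟩

/-- The law, on trajectories indexed by the number of updates, of the rewire-to-random dynamics
started from `s`, with voting probability `ν / L` and rewiring probability `1 - ν / L`. -/
noncomputable def law {N : ℕ} (ν L : ℝ) (s : Config N) : Measure (ℕ → Config N) :=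
  Kernel.trajMeasure (X := fun _ => Config N) (Measure.dirac s) (transition N (ν / L))

/-- `t` is the first time at which the trajectory `X` has no discordant edges. -/
def IsTau {N : ℕ} (X : ℕ → Config N) (t : ℕ) : Prop :=
  IsLeast {m : ℕ | (X m).discordant = ∅} t

/-- The labeled graphs on `N` vertices with `N L / 2` edges and `p N` vertices in state 1. -/
def labeledGraphs (p : ℝ) (N : ℕ) (L : ℝ) : Set (Config N) :=
  {s | (s.graph.edgeSet.ncard : ℝ) = N * L / 2 ∧
    (({v | s.opinion v = true} : Set (Fin N)).ncard : ℝ) = p * N}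

end EvolvingVoter

/-! Two supermartingale arguments run side by side. A vote changes the number of ones by `+1` or
`-1` with equal probability, and votes occur with probability `ν / L`, so over `7 N L` updates the
accumulated variance is at most `7 ν N`. Hence the fraction of ones stays near `p`, and in
particular below a small constant `ρ` (`integral_ones_sq_le`, `IsChain.maximal`). While it is below
`ρ` and discordant edges remain, a potential drops by at least `9/25` per update on average
(`integral_potential_le`). It can fall by at most `1.81 N L` in total (`potential_sub_le`), so a
second-moment bound (`IsChain.stays_le`) forces absorption well before `7 N L`.

The main term of the potential, `edgePotential`, is the excess of half-edges at vertices of degree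
above `K L`, minus the edges between light zeros (state `0`, low degree), both counted with smooth
cutoffs. When `{v, u}` is rewired to `{v, z}`, the new endpoint `z` is typically a light zero. The
potential then falls if `u` is heavy, and also if `v` is a light zero. The zero endpoint of a
discordant edge is heavy or light, so averaging over the two orientations gives drift `-1/2`.

A vote turning a light zero into a one may destroy of order `K L` counted edges. At rate `ν / L`
this is a loss of order one, and it is paid for by a large negative multiple of the sum over ones of
`(1 - q) ^ degree`, where `q = ν / L`. With this base, the loss from ones turned into zeros cancels
the gain from ones losing edges by rewiring, and only the gain from new ones survives
(`le_integral_onesPotential`).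

The endpoint `z` can be atypical when the root `v` is adjacent to almost all vertices. Such updates
are charged to a hub potential, whose drift is at most about minus half their frequency
(`integral_hub_le`) and which is small compared with `N L`. -/

namespace EvolvingVoter

/-! ### Supermartingale estimates for finite Markov chains -/

section Chain

variable {S : Type*} [MeasurableSpace S] [DiscreteMeasurableSpace S]
  {μ : Measure (ℕ → S)} {P : S → PMF S}

/-- `μ` is the law of a Markov chain with one-step transition `P`. -/
def IsChain (μ : Measure (ℕ → S)) (P : S → PMF S) : Prop :=
  ∀ (n : ℕ) (D : Set (Π _ : Finset.Iic n, S)) (f : S → ℝ),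
    ∫ X, (D.indicator 1 (Preorder.frestrictLe n X) : ℝ) * f (X (n + 1)) ∂μ =
      ∫ X, (D.indicator 1 (Preorder.frestrictLe n X) : ℝ) * ∫ t, f t ∂(P (X n)).toMeasure ∂μ

/-- The trajectories which are in `A` at all times before `n`. -/
def stays (A : Set S) (n : ℕ) : Set (ℕ → S) := {X | ∀ m < n, X m ∈ A}

lemma measurableSet_stays (A : Set S) (n : ℕ) : MeasurableSet (stays A n) := by
  have : stays A n = ⋂ m : ℕ, ⋂ _ : m < n, (fun X : ℕ → S => X m) ⁻¹' A := by
    ext X; simp [stays]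
  rw [this]
  exact MeasurableSet.iInter fun m => MeasurableSet.iInter fun _ =>
    measurable_pi_apply m (MeasurableSet.of_discrete)

variable [Finite S] [IsProbabilityMeasure μ]

lemma integrable_indicator_mul {D : Set (ℕ → S)} (hD : MeasurableSet D) (f : S → ℝ) (n : ℕ) :
    Integrable (fun X : ℕ → S => D.indicator 1 X * f (X n)) μ := by
  obtain ⟨c, hc⟩ := (Set.finite_range fun s => |f s|).bddAbove
  refine Integrable.of_bound (C := c) ?_ (ae_of_all _ fun X => ?_)
  · exact ((measurable_one.indicator hD).mul
      ((measurable_of_finite f).comp (measurable_pi_apply n))).aestronglyMeasurable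
  · have h1 : |f (X n)| ≤ c := hc ⟨X n, rfl⟩
    have h0 := abs_nonneg (f (X n))
    rw [Real.norm_eq_abs, abs_mul]
    by_cases h : X ∈ D <;> simp [h] <;> linarith

/-- One step of a time-dependent supermartingale killed on leaving `A`. -/
lemma IsChain.killed_step (hμ : IsChain μ P) (A : Set S) (g g' : S → ℝ) (V : ℝ) (hV : 0 ≤ V)
    (hg : ∀ s ∈ A, ∫ t, g' t ∂(P s).toMeasure ≤ g s + V) (n : ℕ) :
    ∫ X, (stays A (n + 1)).indicator 1 X * g' (X (n + 1)) ∂μ +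
      ∫ X, (stays A n \ stays A (n + 1)).indicator 1 X * g (X n) ∂μ ≤
      ∫ X, (stays A n).indicator 1 X * g (X n) ∂μ + V := by
  have hm := measurableSet_stays A n
  have hm' := measurableSet_stays A (n + 1)
  have key : ∫ X, (stays A (n + 1)).indicator 1 X * g' (X (n + 1)) ∂μ =
      ∫ X, (stays A (n + 1)).indicator 1 X * ∫ t, g' t ∂(P (X n)).toMeasure ∂μ := by
    -- `stays A (n + 1)` constrains the times up to `n` only, so it is an event of the history and
    -- the Markov property applies to it.
    have := hμ n {x | ∀ i, x i ∈ A} g'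
    have hind : ∀ X : ℕ → S, ({x : Π _ : Finset.Iic n, S | ∀ i, x i ∈ A}.indicator 1
        (Preorder.frestrictLe n X) : ℝ) = (stays A (n + 1)).indicator 1 X := by
      intro X
      have : Preorder.frestrictLe (π := fun _ => S) n X ∈ {x : Π _ : Finset.Iic n, S | ∀ i, x i ∈ A} ↔
          X ∈ stays A (n + 1) := by
        simp [stays, Preorder.frestrictLe_apply]
      by_cases h : X ∈ stays A (n + 1)
      · rw [Set.indicator_of_mem h, Set.indicator_of_mem (this.2 h)]; rfl
      · rw [Set.indicator_of_notMem h, Set.indicator_of_notMem (fun h' => h (this.1 h'))]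
    simpa only [hind] using this
  rw [key, ← integral_add (integrable_indicator_mul hm' (fun s => ∫ t, g' t ∂(P s).toMeasure) n)
    (integrable_indicator_mul (hm.diff hm') g n)]
  have hVi : ∫ _ : ℕ → S, V ∂μ = V := by simp
  rw [← hVi, ← integral_add (integrable_indicator_mul hm g n) (integrable_const V)]
  refine integral_mono ((integrable_indicator_mul hm' (fun s => ∫ t, g' t ∂(P s).toMeasure) n).add
    (integrable_indicator_mul (hm.diff hm') g n))
    ((integrable_indicator_mul hm g n).add (integrable_const V)) fun X => ?_
  by_cases h : X ∈ stays A n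
  · by_cases h' : X ∈ stays A (n + 1)
    · have := hg (X n) (h' n (Nat.lt_succ_self n))
      simp [h, h']; linarith
    · simp [h, h']; linarith
  · have h' : X ∉ stays A (n + 1) := fun hX => h fun m hm => hX m (by omega)
    simp [h, h']; exact hV

/-- A nonnegative function which grows by at most `V` per step on average exceeds `r` at some
time up to `n` with probability at most `(g s₀ + n V) / r`. -/
lemma IsChain.maximal (hμ : IsChain μ P) {s₀ : S} (h0 : ∀ᵐ X ∂μ, X 0 = s₀) (g : S → ℝ)
    (hg0 : ∀ s, 0 ≤ g s) {V r : ℝ} (hV : 0 ≤ V) (hr : 0 < r)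
    (hg : ∀ s, g s < r → ∫ t, g t ∂(P s).toMeasure ≤ g s + V) (n : ℕ) :
    μ.real {X | ∃ m ≤ n, r ≤ g (X m)} ≤ (g s₀ + n * V) / r := by
  set A : Set S := {s | g s < r}
  -- Trajectories that have left `A` are frozen at the value `r`, which `g` has reached on exit.
  -- This stopped process grows by at most `V` per step in mean.
  have main : ∀ n : ℕ, ∫ X, (stays A n).indicator 1 X * g (X n) ∂μ +
      r * μ.real (stays A n)ᶜ ≤ g s₀ + n * V := by
    intro n
    induction n with
    | zero =>
      have : stays A 0 = Set.univ := by ext X; simp [stays]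
      simp only [this, Set.indicator_univ, Pi.one_apply, one_mul, Set.compl_univ,
        measureReal_empty, mul_zero, Nat.cast_zero, zero_mul, add_zero]
      rw [integral_congr_ae (g := fun _ => g s₀) (h0.mono fun X hX => by simp [hX])]
      simp
    | succ n ih =>
      have hs := hμ.killed_step A g g V hV (fun s hs => hg s hs) n
      have hm := measurableSet_stays A n
      have hm' := measurableSet_stays A (n + 1)
      have hsub : stays A (n + 1) ⊆ stays A n := fun X hX m hm => hX m (by omega)
      have h2 : r * μ.real (stays A n \ stays A (n + 1)) ≤
          ∫ X, (stays A n \ stays A (n + 1)).indicator 1 X * g (X n) ∂μ := by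
        have : r * μ.real (stays A n \ stays A (n + 1)) =
            ∫ X, (stays A n \ stays A (n + 1)).indicator 1 X * (fun _ => r) (X n) ∂μ := by
          rw [integral_mul_const, integral_indicator_one (hm.diff hm'), mul_comm]
        rw [this]
        refine integral_mono (integrable_indicator_mul (hm.diff hm') (fun _ => r) n)
          (integrable_indicator_mul (hm.diff hm') g n) fun X => ?_
        by_cases h : X ∈ stays A n \ stays A (n + 1)
        · simp only [Set.indicator_of_mem h, Pi.one_apply, one_mul]
          by_contra hc
          refine h.2 fun m hm => ?_
          rcases Nat.lt_succ_iff_lt_or_eq.1 hm with h1 | rfl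
          · exact h.1 m h1
          · exact not_le.1 hc
        · simp [Set.indicator_of_notMem h]
      have h3 : μ.real (stays A (n + 1))ᶜ =
          μ.real (stays A n)ᶜ + μ.real (stays A n \ stays A (n + 1)) := by
        rw [← measureReal_union _ (hm.diff hm')]
        · congr 1; ext X
          simp only [Set.mem_compl_iff, Set.mem_union, Set.mem_sdiff]
          constructor
          · intro h; tauto
          · rintro (h | h)
            · exact fun h' => h (hsub h')
            · exact h.2
        · exact Set.disjoint_left.2 fun X h h' => h h'.1
      rw [h3]; push_cast; linarith
  rw [le_div_iff₀ hr]
  have hset : {X : ℕ → S | ∃ m ≤ n, r ≤ g (X m)} = (stays A (n + 1))ᶜ := by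
    ext X; simp [stays, A]
  have hn := main n
  have hm := measurableSet_stays A n
  have hm' := measurableSet_stays A (n + 1)
  -- `main n` counts exits strictly before time `n`; an exit at time `n` itself is paid for by the
  -- remaining integral of `g`.
  have h2 : r * μ.real (stays A n \ stays A (n + 1)) ≤
      ∫ X, (stays A n).indicator 1 X * g (X n) ∂μ := by
    have : r * μ.real (stays A n \ stays A (n + 1)) =
        ∫ X, (stays A n \ stays A (n + 1)).indicator 1 X * (fun _ => r) (X n) ∂μ := by
      rw [integral_mul_const, integral_indicator_one (hm.diff hm'), mul_comm]
    rw [this]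
    refine integral_mono (integrable_indicator_mul (hm.diff hm') (fun _ => r) n)
      (integrable_indicator_mul hm g n) fun X => ?_
    by_cases h : X ∈ stays A n \ stays A (n + 1)
    · simp only [Set.indicator_of_mem h, Set.indicator_of_mem h.1, Pi.one_apply, one_mul]
      by_contra hc
      refine h.2 fun m hm => ?_
      rcases Nat.lt_succ_iff_lt_or_eq.1 hm with h1 | rfl
      · exact h.1 m h1
      · exact not_le.1 hc
    · simp only [Set.indicator_of_notMem h, zero_mul]
      exact mul_nonneg (Set.indicator_nonneg (fun _ _ => zero_le_one) _) (hg0 _)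
  have h3 : μ.real (stays A (n + 1))ᶜ ≤
      μ.real (stays A n)ᶜ + μ.real (stays A n \ stays A (n + 1)) := by
    refine le_trans (measureReal_mono ?_) (measureReal_union_le _ _)
    intro X hX
    by_cases h : X ∈ stays A n
    · exact Or.inr ⟨h, hX⟩
    · exact Or.inl h
  rw [hset]
  nlinarith [mul_le_mul_of_nonneg_left h3 hr.le]

/-- Mean increments will be bounded from above only, so the cross term must carry a nonnegative
factor. This is why the positive part is squared. -/
lemma sq_posPart_add_le (x d : ℝ) : (max 0 (x + d)) ^ 2 ≤ (max 0 x) ^ 2 + 2 * max 0 x * d + d ^ 2 := by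
  rcases le_total 0 x with hx | hx
  · rw [max_eq_right hx]
    rcases le_total 0 (x + d) with h | h
    · rw [max_eq_right h]; nlinarith
    · rw [max_eq_left h]; nlinarith [sq_nonneg (x + d)]
  · rw [max_eq_left hx]
    rcases le_total 0 (x + d) with h | h
    · rw [max_eq_right h]; nlinarith
    · rw [max_eq_left h]; nlinarith [sq_nonneg d]

/-- If `Ψ` decreases by at least `c` per step on average while the chain is in `A`, with second
moments at most `V`, and `Ψ` has oscillation at most `B` on `A`, then the chain is unlikely
to be in `A` for substantially more than `B / c` steps. -/
lemma IsChain.stays_le (hμ : IsChain μ P) {s₀ : S} (h0 : ∀ᵐ X ∂μ, X 0 = s₀) (A : Set S)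
    (Ψ : S → ℝ) {c V B : ℝ} (hV : 0 ≤ V)
    (h1 : ∀ s ∈ A, ∫ t, (Ψ t - Ψ s) ∂(P s).toMeasure ≤ -c)
    (h2 : ∀ s ∈ A, ∫ t, (Ψ t - Ψ s + c) ^ 2 ∂(P s).toMeasure ≤ V)
    (hB : ∀ s ∈ A, Ψ s₀ - Ψ s ≤ B) (n : ℕ) (hn : B < c * n) :
    μ.real {X | ∀ m ≤ n, X m ∈ A} ≤ n * V / (c * n - B) ^ 2 := by
  -- Chebyshev for the compensated process `Ψ (X n) + c n - Ψ s₀`: the squared positive part gains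
  -- at most `V` per step, and if the chain is still in `A` at time `n` the process is at least `c n
  -- - B`.
  have main : ∀ n : ℕ, ∫ X, (stays A n).indicator 1 X * (max 0 (Ψ (X n) + c * n - Ψ s₀)) ^ 2 ∂μ
      ≤ n * V := by
    intro n
    induction n with
    | zero =>
      have : stays A 0 = Set.univ := by ext X; simp [stays]
      simp only [this, Set.indicator_univ, Pi.one_apply, one_mul, Nat.cast_zero, mul_zero,
        add_zero, zero_mul]
      rw [integral_congr_ae (g := fun _ => (0 : ℝ)) (h0.mono fun X hX => by simp [hX])]
      simp
    | succ n ih =>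
      have hs := hμ.killed_step A (fun s => (max 0 (Ψ s + c * n - Ψ s₀)) ^ 2)
        (fun s => (max 0 (Ψ s + c * (n + 1 : ℕ) - Ψ s₀)) ^ 2) V hV (fun s hs => ?_) n
      · have hnn : 0 ≤ ∫ X, (stays A n \ stays A (n + 1)).indicator 1 X *
            (max 0 (Ψ (X n) + c * n - Ψ s₀)) ^ 2 ∂μ :=
          integral_nonneg fun X => mul_nonneg (Set.indicator_nonneg (fun _ _ => zero_le_one) _)
            (sq_nonneg _)
        push_cast at hs ⊢; linarith
      · set x := Ψ s + c * n - Ψ s₀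
        have hle : ∫ t, (max 0 (Ψ t + c * (n + 1 : ℕ) - Ψ s₀)) ^ 2 ∂(P s).toMeasure ≤
            ∫ t, ((max 0 x) ^ 2 + 2 * max 0 x * (Ψ t - Ψ s + c) + (Ψ t - Ψ s + c) ^ 2)
              ∂(P s).toMeasure := by
          refine integral_mono .of_finite .of_finite fun t => ?_
          have e : Ψ t + c * (n + 1 : ℕ) - Ψ s₀ = x + (Ψ t - Ψ s + c) := by
            simp only [x]; push_cast; ring
          simpa only [e] using sq_posPart_add_le x (Ψ t - Ψ s + c)
        have e1 : ∫ t, (Ψ t - Ψ s + c) ∂(P s).toMeasure ≤ 0 := by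
          rw [integral_add .of_finite .of_finite]; simp; linarith [h1 s hs]
        rw [integral_add .of_finite .of_finite, integral_add .of_finite .of_finite,
          integral_const_mul] at hle
        simp only [integral_const, probReal_univ, one_smul] at hle
        have e2 := h2 s hs
        have e3 : 0 ≤ 2 * max 0 x := by positivity
        nlinarith [mul_nonneg e3 (neg_nonneg.2 e1)]
  have h := main n
  have hpos : 0 < (c * n - B) ^ 2 := by have : 0 < c * n - B := by linarith
                                        positivity
  rw [le_div_iff₀ hpos]
  refine le_trans ?_ h
  have hm := measurableSet_stays A (n + 1)
  have hset : {X : ℕ → S | ∀ m ≤ n, X m ∈ A} = stays A (n + 1) := by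
    ext X; simp [stays]
  have : μ.real (stays A (n + 1)) * (c * n - B) ^ 2 =
      ∫ X, (stays A (n + 1)).indicator 1 X * (fun _ => (c * n - B) ^ 2) (X n) ∂μ := by
    rw [integral_mul_const, integral_indicator_one hm]
  rw [hset, this]
  refine integral_mono (integrable_indicator_mul hm (fun _ => (c * n - B) ^ 2) n)
    (integrable_indicator_mul (measurableSet_stays A n)
      (fun s => (max 0 (Ψ s + c * n - Ψ s₀)) ^ 2) n) fun X => ?_
  by_cases hX : X ∈ stays A (n + 1)
  · have hX' : X ∈ stays A n := fun m hm => hX m (by omega)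
    simp only [Set.indicator_of_mem hX, Set.indicator_of_mem hX', Pi.one_apply, one_mul]
    have := hB _ (hX n (Nat.lt_succ_self n))
    refine pow_le_pow_left₀ (by linarith) (le_trans ?_ (le_max_right _ _)) 2
    linarith
  · simp only [Set.indicator_of_notMem hX, zero_mul]
    exact mul_nonneg (Set.indicator_nonneg (fun _ _ => zero_le_one) _) (sq_nonneg _)

end Chain

/-! ### The law of the dynamics as a Markov chain -/

instance (N : ℕ) : Finite (Config N) :=
  Finite.of_injective (fun s : Config N => (s.graph, s.opinion)) fun s t h => by
    ext1 <;> simp_all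

instance (N : ℕ) : DiscreteMeasurableSpace (Config N) := ⟨fun _ => trivial⟩

instance {N : ℕ} (ν L : ℝ) (s : Config N) : IsProbabilityMeasure (law ν L s) := by
  unfold law; infer_instance

/-- The joint law of the history and the next configuration is the composition product of the
history's law with the transition kernel. Finiteness of the state space settles integrability. -/
lemma isChain_law {N : ℕ} (ν L : ℝ) (s : Config N) : IsChain (law ν L s) (step (ν / L)) := by
  intro n D f
  have h := Kernel.map_frestrictLe_trajMeasure_compProd_eq_map_trajMeasure
    (X := fun _ => Config N) (μ₀ := Measure.dirac s) (κ := transition N (ν / L)) (a := n)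
  change (law ν L s).map _ ⊗ₘ _ = (law ν L s).map _ at h
  set F : (Π _ : Finset.Iic n, Config N) × Config N → ℝ := fun p => D.indicator 1 p.1 * f p.2
  have hF : ∀ m : Measure ((Π _ : Finset.Iic n, Config N) × Config N),
      AEStronglyMeasurable F m := fun m => (measurable_of_finite F).aestronglyMeasurable
  have e1 : ∫ X, (D.indicator 1 (Preorder.frestrictLe n X) : ℝ) * f (X (n + 1)) ∂(law ν L s) =
      ∫ p, F p ∂((law ν L s).map (fun x => (Preorder.frestrictLe n x, x (n + 1)))) := by
    rw [integral_map (by fun_prop) (hF _)]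
  have e2 : ∫ X, (D.indicator 1 (Preorder.frestrictLe n X) : ℝ) *
        ∫ t, f t ∂(step (ν / L) (X n)).toMeasure ∂(law ν L s) =
      ∫ x, ∫ t, F (x, t) ∂(transition N (ν / L) n x) ∂((law ν L s).map (Preorder.frestrictLe n)) := by
    rw [integral_map (by fun_prop) (measurable_of_finite _).aestronglyMeasurable]
    simp only [F, integral_const_mul]
    rfl
  have : IsProbabilityMeasure ((law ν L s).map (Preorder.frestrictLe (π := fun _ => Config N) n)) :=
    Measure.isProbabilityMeasure_map (by fun_prop)
  rw [e1, e2, ← h, Measure.integral_compProd]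
  exact .of_finite

lemma law_zero {N : ℕ} (ν L : ℝ) (s : Config N) : ∀ᵐ X ∂(law ν L s), X 0 = s := by
  have h : (law ν L s).map (Preorder.frestrictLe 0) =
      Measure.dirac ((MeasurableEquiv.piUnique (fun _ : Finset.Iic 0 => Config N)).symm s) := by
    rw [law, Kernel.trajMeasure, Measure.map_comp _ _ (by fun_prop), Kernel.traj_map_frestrictLe,
      Kernel.partialTraj_self, Measure.id_comp]
    exact Measure.map_dirac' (MeasurableEquiv.measurable _) _
  have h2 : ∀ᵐ x ∂((law ν L s).map (Preorder.frestrictLe (π := fun _ => Config N) 0)),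
      x ⟨0, Finset.mem_Iic.2 le_rfl⟩ = s := by
    rw [h, ae_dirac_iff (MeasurableSet.of_discrete
      (s := {x : Π _ : Finset.Iic 0, Config N | x ⟨0, Finset.mem_Iic.2 le_rfl⟩ = s}))]
    rfl
  exact ae_of_ae_map (by fun_prop) h2

/-! ### Mean increments as averages over discordant edges and rewiring targets -/

lemma integral_pmf_bind {α β : Type*} [Fintype α] [Finite β] [MeasurableSpace β]
    [DiscreteMeasurableSpace β] (p : PMF α) (k : α → PMF β) (f : β → ℝ) :
    ∫ b, f b ∂(p.bind k).toMeasure = ∑ a, (p a).toReal * ∫ b, f b ∂(k a).toMeasure := by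
  have := Fintype.ofFinite β
  simp only [PMF.integral_eq_sum, PMF.bind_apply, tsum_fintype, smul_eq_mul]
  simp_rw [Finset.mul_sum]
  rw [Finset.sum_comm]
  refine Finset.sum_congr rfl fun b _ => ?_
  rw [ENNReal.toReal_sum fun a _ => ENNReal.mul_ne_top (p.apply_ne_top a) ((k a).apply_ne_top b),
    Finset.sum_mul]
  refine Finset.sum_congr rfl fun a _ => ?_
  rw [ENNReal.toReal_mul, mul_assoc]

lemma integral_pmf_pure {β : Type*} [Finite β] [MeasurableSpace β]
    [DiscreteMeasurableSpace β] (b : β) (f : β → ℝ) :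
    ∫ x, f x ∂(PMF.pure b).toMeasure = f b := by
  rw [PMF.toMeasure_pure, integral_dirac]

lemma sum_uniformOfFinset {α : Type*} [Fintype α] (s : Finset α) (hs : s.Nonempty) (F : α → ℝ) :
    ∑ a, (PMF.uniformOfFinset s hs a).toReal * F a = (∑ a ∈ s, F a) / s.card := by
  classical
  rw [Finset.sum_div, ← Finset.sum_subset (Finset.subset_univ s)]
  · refine Finset.sum_congr rfl fun a ha => ?_
    rw [PMF.uniformOfFinset_apply_of_mem hs ha, ENNReal.toReal_inv, ENNReal.toReal_natCast,
      div_eq_inv_mul]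
  · intro a _ ha
    rw [PMF.uniformOfFinset_apply_of_notMem hs ha]; simp

lemma coin_apply_true {q : ℝ} (h0 : 0 ≤ q) (h1 : q ≤ 1) : (coin q true).toReal = q := by
  simp [coin, h0, h1]

lemma coin_apply_false {q : ℝ} (h0 : 0 ≤ q) (h1 : q ≤ 1) : (coin q false).toReal = 1 - q := by
  simp [coin, h0, h1]

variable {N : ℕ}

/-- Average over the oriented discordant edges. -/
noncomputable def davg (s : Config N) (F : Fin N × Fin N → ℝ) : ℝ :=
  (∑ e ∈ s.discordant, F e) / s.discordant.card

/-- Average over the vertices to which `v` may rewire, `0` if there are none. -/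
noncomputable def tavg (s : Config N) (v : Fin N) (F : Fin N → ℝ) : ℝ :=
  (∑ z ∈ s.targets v, F z) / (s.targets v).card

/-- Requiring `φ s = 0` makes the case without targets, where nothing moves, agree with the
convention that an empty average is `0 / 0 = 0`. -/
lemma integral_rewire (s : Config N) (v u : Fin N) (φ : Config N → ℝ) (hφ : φ s = 0) :
    ∫ t, φ t ∂(s.rewire v u).toMeasure = tavg s v fun z => φ (s.moveEdge v u z) := by
  unfold Config.rewire tavg
  split_ifs with h
  · rw [← PMF.bind_pure_comp, integral_pmf_bind]
    simp only [Function.comp, integral_pmf_pure]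
    rw [sum_uniformOfFinset]
  · rw [integral_pmf_pure, hφ, Finset.not_nonempty_iff_eq_empty.1 h]; simp

/-- The mean increment of a function along one update. -/
lemma integral_step {q : ℝ} (h0 : 0 ≤ q) (h1 : q ≤ 1) (s : Config N) (φ : Config N → ℝ)
    (hφ : φ s = 0) :
    ∫ t, φ t ∂(step q s).toMeasure = davg s fun e =>
      q * φ (s.imitate e.1 e.2) + (1 - q) * tavg s e.1 fun z => φ (s.moveEdge e.1 e.2 z) := by
  unfold step davg
  split_ifs with h
  · rw [integral_pmf_bind, sum_uniformOfFinset]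
    congr 1
    refine Finset.sum_congr rfl fun e _ => ?_
    rw [integral_pmf_bind, Fintype.sum_bool, coin_apply_true h0 h1, coin_apply_false h0 h1]
    simp only [if_true, Bool.false_eq_true, if_false, integral_pmf_pure]
    rw [integral_rewire _ _ _ _ hφ]
  · rw [integral_pmf_pure, hφ, Finset.not_nonempty_iff_eq_empty.1 h]; simp

section Averages

variable (s : Config N)

lemma davg_mono {F G : Fin N × Fin N → ℝ} (h : ∀ e ∈ s.discordant, F e ≤ G e) :
    davg s F ≤ davg s G :=
  div_le_div_of_nonneg_right (Finset.sum_le_sum h) (Nat.cast_nonneg _)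

lemma davg_add (F G : Fin N × Fin N → ℝ) : davg s (fun e => F e + G e) = davg s F + davg s G := by
  simp only [davg, Finset.sum_add_distrib, add_div]

lemma davg_const_mul (c : ℝ) (F : Fin N × Fin N → ℝ) : davg s (fun e => c * F e) = c * davg s F := by
  simp only [davg, ← Finset.mul_sum, mul_div_assoc]

lemma davg_const (h : s.discordant.Nonempty) (c : ℝ) : davg s (fun _ => c) = c := by
  have : (s.discordant.card : ℝ) ≠ 0 := by exact_mod_cast h.card_pos.ne'
  simp only [davg, Finset.sum_const, nsmul_eq_mul]
  field_simp

lemma davg_nonneg {F : Fin N × Fin N → ℝ} (h : ∀ e ∈ s.discordant, 0 ≤ F e) : 0 ≤ davg s F :=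
  div_nonneg (Finset.sum_nonneg h) (Nat.cast_nonneg _)

lemma mem_discordant {s : Config N} {e : Fin N × Fin N} :
    e ∈ s.discordant ↔ s.graph.Adj e.1 e.2 ∧ s.opinion e.1 ≠ s.opinion e.2 := by
  simp [Config.discordant]

lemma mem_targets {s : Config N} {v z : Fin N} :
    z ∈ s.targets v ↔ z ≠ v ∧ ¬ s.graph.Adj v z := by
  simp [Config.targets]

/-- The orientation is uniform, so reversal permutes the oriented discordant edges. Every
cancellation between the two endpoints of an edge comes from this symmetry. -/
lemma davg_swap (F : Fin N × Fin N → ℝ) : davg s (fun e => F e.swap) = davg s F := by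
  unfold davg
  congr 1
  refine Finset.sum_nbij' Prod.swap Prod.swap ?_ ?_ ?_ ?_ ?_
  · intro e he
    rw [mem_discordant] at he ⊢
    exact ⟨he.1.symm, he.2.symm⟩
  · intro e he
    rw [mem_discordant] at he ⊢
    exact ⟨he.1.symm, he.2.symm⟩
  · simp
  · simp
  · simp

lemma tavg_mono (v : Fin N) {F G : Fin N → ℝ} (h : ∀ z ∈ s.targets v, F z ≤ G z) :
    tavg s v F ≤ tavg s v G :=
  div_le_div_of_nonneg_right (Finset.sum_le_sum h) (Nat.cast_nonneg _)

lemma tavg_add (v : Fin N) (F G : Fin N → ℝ) :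
    tavg s v (fun e => F e + G e) = tavg s v F + tavg s v G := by
  simp only [tavg, Finset.sum_add_distrib, add_div]

lemma tavg_const_mul (v : Fin N) (c : ℝ) (F : Fin N → ℝ) :
    tavg s v (fun e => c * F e) = c * tavg s v F := by
  simp only [tavg, ← Finset.mul_sum, mul_div_assoc]

lemma tavg_const {v : Fin N} (h : (s.targets v).Nonempty) (c : ℝ) : tavg s v (fun _ => c) = c := by
  have : ((s.targets v).card : ℝ) ≠ 0 := by exact_mod_cast h.card_pos.ne'
  simp only [tavg, Finset.sum_const, nsmul_eq_mul]
  field_simp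

lemma tavg_const_le (v : Fin N) {c : ℝ} (hc : 0 ≤ c) : tavg s v (fun _ => c) ≤ c := by
  rcases (s.targets v).eq_empty_or_nonempty with h | h
  · simpa [tavg, h] using hc
  · exact (tavg_const s h c).le

lemma tavg_eq_zero {v : Fin N} (h : ¬ (s.targets v).Nonempty) (F : Fin N → ℝ) : tavg s v F = 0 := by
  simp [tavg, Finset.not_nonempty_iff_eq_empty.1 h]

lemma tavg_le_of_le (v : Fin N) {F : Fin N → ℝ} {c : ℝ} (hc : 0 ≤ c)
    (h : ∀ z ∈ s.targets v, F z ≤ c) : tavg s v F ≤ c :=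
  (tavg_mono s v h).trans (tavg_const_le s v hc)

lemma tavg_nonneg (v : Fin N) {F : Fin N → ℝ} (h : ∀ z ∈ s.targets v, 0 ≤ F z) : 0 ≤ tavg s v F :=
  div_nonneg (Finset.sum_nonneg h) (Nat.cast_nonneg _)

open Classical in
/-- A set of `m` vertices is hit with probability at most `m / k` when there are at least
`k` targets. -/
lemma tavg_indicator_le (v : Fin N) (p : Fin N → Prop) {m k : ℝ} (hk : 0 < k)
    (hT : k ≤ (s.targets v).card) (hm : ((Finset.univ.filter p).card : ℝ) ≤ m) :
    tavg s v (fun z => if p z then 1 else 0) ≤ m / k := by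
  unfold tavg
  rw [← Finset.sum_filter, Finset.sum_const, nsmul_eq_mul, mul_one]
  refine div_le_div₀ ((Nat.cast_nonneg _).trans hm) ?_ hk hT
  refine le_trans ?_ hm
  exact_mod_cast Finset.card_le_card (Finset.filter_subset_filter _ (Finset.subset_univ _))

end Averages

/-! ### Degrees, adjacency matrix and the effect of moving an edge -/

open Classical in
/-- The degree of a vertex. -/
noncomputable def Config.deg (s : Config N) (v : Fin N) : ℕ :=
  (Finset.univ.filter (s.graph.Adj v)).card

open Classical in
/-- The adjacency matrix. -/
noncomputable def Config.adj (s : Config N) (a b : Fin N) : ℝ := if s.graph.Adj a b then 1 else 0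

namespace Config

variable (s : Config N)

lemma adj_nonneg (a b : Fin N) : 0 ≤ s.adj a b := by unfold adj; split_ifs <;> norm_num

lemma adj_le_one (a b : Fin N) : s.adj a b ≤ 1 := by unfold adj; split_ifs <;> norm_num

lemma adj_symm (a b : Fin N) : s.adj a b = s.adj b a := by
  classical exact if_congr (s.graph.adj_comm a b) rfl rfl

lemma sum_adj (v : Fin N) : ∑ b, s.adj v b = s.deg v := by simp [adj, deg]

lemma deg_add_card_targets (v : Fin N) : s.deg v + (s.targets v).card + 1 = N := by
  classical
  have h : (Finset.univ : Finset (Fin N)) =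
      insert v ((Finset.univ.filter (s.graph.Adj v)) ∪ s.targets v) := by
    ext z; simp [mem_targets]; tauto
  have h2 : N = (Finset.univ : Finset (Fin N)).card := by simp
  conv_rhs => rw [h2, h]
  rw [Finset.card_insert_of_notMem (by simp [mem_targets]), Finset.card_union_of_disjoint]
  · simp [deg]
  · rw [Finset.disjoint_left]; intro z hz hz'
    simp [mem_targets] at hz hz'; tauto

lemma deg_lt (v : Fin N) : s.deg v < N := by have := s.deg_add_card_targets v; omega

@[simp] lemma imitate_deg (v u : Fin N) : (s.imitate v u).deg = s.deg := rfl

/-- The indicator of the unordered pair `{x, y}`. -/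
def pairInd (x y a b : Fin N) : ℝ :=
  (if a = x then 1 else 0) * (if b = y then 1 else 0) +
    (if a = y then 1 else 0) * (if b = x then 1 else 0)

variable {s} {v u z : Fin N}

open Classical in
lemma moveEdge_adj (h : s.graph.Adj v u) (hz : z ∈ s.targets v) (a b : Fin N) :
    (s.moveEdge v u z).adj a b = s.adj a b - pairInd v u a b + pairInd v z a b := by
  rw [mem_targets] at hz
  have huv : v ≠ u := h.ne
  have huz : u ≠ z := fun e => hz.2 (e ▸ h)
  have hz1 := hz.1
  have key : (s.moveEdge v u z).graph.Adj a b ↔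
      (s.graph.Adj a b ∧ ¬ ((a = v ∧ b = u) ∨ (a = u ∧ b = v))) ∨
        ((a = v ∧ b = z) ∨ (a = z ∧ b = v)) := by
    simp only [moveEdge, SimpleGraph.sup_adj, SimpleGraph.deleteEdges_adj, Set.mem_singleton_iff,
      Sym2.eq_iff, SimpleGraph.edge_adj]
    constructor
    · rintro (⟨h1, h2⟩ | ⟨h1, h2⟩)
      · exact Or.inl ⟨h1, h2⟩
      · exact Or.inr h1
    · rintro (⟨h1, h2⟩ | h1)
      · exact Or.inl ⟨h1, h2⟩
      · refine Or.inr ⟨h1, ?_⟩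
        rintro rfl
        rcases h1 with ⟨rfl, rfl⟩ | ⟨rfl, rfl⟩ <;> exact hz1 rfl
  have hzv : ¬ s.graph.Adj z v := fun e => hz.2 e.symm
  have e : (s.moveEdge v u z).adj a b = if (s.graph.Adj a b ∧ ¬ ((a = v ∧ b = u) ∨
      (a = u ∧ b = v))) ∨ ((a = v ∧ b = z) ∨ (a = z ∧ b = v)) then 1 else 0 := if_congr key rfl rfl
  rw [e]
  unfold adj
  simp only [pairInd]
  clear key e
  by_cases e1 : a = v
  · subst e1
    by_cases e2 : b = u
    · subst e2; simp [h, huv, huz, Ne.symm huv, Ne.symm hz1]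
    · by_cases e3 : b = z
      · subst e3; simp [hz.2, huv, Ne.symm huz, Ne.symm hz1, hz1]
      · simp [e2, e3, huv, Ne.symm hz1]
  · by_cases e2 : b = v
    · subst e2
      by_cases e3 : a = u
      · subst e3; simp [h.symm, huv, huz, Ne.symm huv, Ne.symm hz1]
      · by_cases e4 : a = z
        · subst e4; simp [hzv, huv, Ne.symm huz, Ne.symm hz1, hz1]
        · simp [e1, e3, e4]
    · simp [e1, e2]

/-- The sum of `f a f b` over ordered pairs of neighbours. -/
noncomputable def pairSum (s : Config N) (f : Fin N → ℝ) : ℝ := ∑ a, ∑ b, s.adj a b * (f a * f b)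

lemma sum_pairInd (x y : Fin N) (g : Fin N → Fin N → ℝ) :
    ∑ a, ∑ b, pairInd x y a b * g a b = g x y + g y x := by
  simp [pairInd, add_mul, Finset.sum_add_distrib]

lemma sum_pairInd_left (x y a : Fin N) :
    ∑ b, pairInd x y a b = (if a = x then 1 else 0) + (if a = y then 1 else 0) := by
  simp [pairInd, Finset.sum_add_distrib]

lemma pairSum_moveEdge (h : s.graph.Adj v u) (hz : z ∈ s.targets v) (f : Fin N → ℝ) :
    (s.moveEdge v u z).pairSum f = s.pairSum f - 2 * (f v * f u) + 2 * (f v * f z) := by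
  unfold pairSum
  simp only [moveEdge_adj h hz, add_mul, sub_mul, Finset.sum_add_distrib, Finset.sum_sub_distrib]
  rw [sum_pairInd v u fun a b => f a * f b, sum_pairInd v z fun a b => f a * f b]
  ring

lemma moveEdge_deg_cast (h : s.graph.Adj v u) (hz : z ∈ s.targets v) (a : Fin N) :
    ((s.moveEdge v u z).deg a : ℝ) =
      s.deg a - (if a = u then 1 else 0) + (if a = z then 1 else 0) := by
  rw [← sum_adj, ← sum_adj]
  simp only [moveEdge_adj h hz, Finset.sum_add_distrib, Finset.sum_sub_distrib, sum_pairInd_left]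
  ring

lemma ne_of_mem_targets (h : s.graph.Adj v u) (hz : z ∈ s.targets v) : u ≠ z :=
  fun e => (mem_targets.1 hz).2 (e ▸ h)

lemma deg_pos_of_adj (h : s.graph.Adj v u) : 0 < s.deg u :=
  Finset.card_pos.2 ⟨v, by simpa using h.symm⟩

lemma moveEdge_deg_left (h : s.graph.Adj v u) (hz : z ∈ s.targets v) :
    (s.moveEdge v u z).deg u + 1 = s.deg u := by
  have := moveEdge_deg_cast h hz u
  simp only [if_true, ne_of_mem_targets h hz, if_false] at this
  have h2 : (((s.moveEdge v u z).deg u + 1 : ℕ) : ℝ) = s.deg u := by push_cast; linarith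
  exact_mod_cast h2

lemma moveEdge_deg_target (h : s.graph.Adj v u) (hz : z ∈ s.targets v) :
    (s.moveEdge v u z).deg z = s.deg z + 1 := by
  have := moveEdge_deg_cast h hz z
  simp only [if_true, (ne_of_mem_targets h hz).symm, if_false] at this
  have h2 : ((s.moveEdge v u z).deg z : ℝ) = ((s.deg z + 1 : ℕ) : ℝ) := by push_cast; linarith
  exact_mod_cast h2

lemma moveEdge_deg_of_ne (h : s.graph.Adj v u) (hz : z ∈ s.targets v) {a : Fin N} (h1 : a ≠ u)
    (h2 : a ≠ z) : (s.moveEdge v u z).deg a = s.deg a := by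
  have := moveEdge_deg_cast h hz a
  simp only [h1, h2, if_false, sub_zero, add_zero] at this
  exact_mod_cast this

/-- Only the degrees of `u` and `z` change when `{v, u}` is replaced by `{v, z}`. -/
lemma sum_moveEdge_sub (h : s.graph.Adj v u) (hz : z ∈ s.targets v) (F : Fin N → ℕ → ℝ) :
    ∑ a, F a ((s.moveEdge v u z).deg a) - ∑ a, F a (s.deg a) =
      (F u (s.deg u - 1) - F u (s.deg u)) + (F z (s.deg z + 1) - F z (s.deg z)) := by
  classical
  rw [← Finset.sum_sub_distrib]
  have huz := ne_of_mem_targets h hz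
  rw [← Finset.sum_subset (Finset.subset_univ {u, z})]
  · rw [Finset.sum_pair huz, moveEdge_deg_target h hz]
    have := moveEdge_deg_left h hz
    rw [show s.deg u - 1 = (s.moveEdge v u z).deg u by omega]
  · intro a _ ha
    simp only [Finset.mem_insert, Finset.mem_singleton, not_or] at ha
    rw [moveEdge_deg_of_ne h hz ha.1 ha.2, sub_self]

/-- Twice the number of edges. -/
noncomputable def totalDeg (s : Config N) : ℕ := ∑ v, s.deg v

lemma totalDeg_moveEdge (h : s.graph.Adj v u) (hz : z ∈ s.targets v) :
    (s.moveEdge v u z).totalDeg = s.totalDeg := by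
  have h1 := sum_moveEdge_sub h hz fun _ d => (d : ℝ)
  have h2 := deg_pos_of_adj h
  simp only [Nat.cast_sub h2] at h1
  push_cast at h1
  unfold totalDeg
  have : ((∑ a, (s.moveEdge v u z).deg a : ℕ) : ℝ) = (∑ a, s.deg a : ℕ) := by
    push_cast; linarith
  exact_mod_cast this

lemma totalDeg_imitate (v u : Fin N) : (s.imitate v u).totalDeg = s.totalDeg := rfl

lemma totalDeg_eq (s : Config N) : s.totalDeg = 2 * s.graph.edgeSet.ncard := by
  classical
  have := s.graph.sum_degrees_eq_twice_card_edges
  rw [← SimpleGraph.coe_edgeFinset, Set.ncard_coe_finset, ← this]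
  refine Finset.sum_congr rfl fun v _ => ?_
  rw [← SimpleGraph.card_neighborFinset_eq_degree]
  unfold deg
  congr 1
  ext; simp

/-- Markov's inequality for the degrees. -/
lemma card_deg_gt (s : Config N) {x : ℝ} (p : Fin N → Prop) [DecidablePred p]
    (hp : ∀ v, p v → x ≤ s.deg v) : ((Finset.univ.filter p).card : ℝ) * x ≤ s.totalDeg := by
  have : (s.totalDeg : ℝ) = ∑ v, (s.deg v : ℝ) := by simp [totalDeg]
  rw [this]
  calc ((Finset.univ.filter p).card : ℝ) * x = ∑ v ∈ Finset.univ.filter p, x := by simp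
    _ ≤ ∑ v ∈ Finset.univ.filter p, (s.deg v : ℝ) :=
        Finset.sum_le_sum fun v hv => hp v (by simpa using hv)
    _ ≤ _ := Finset.sum_le_sum_of_subset_of_nonneg (Finset.subset_univ _) fun _ _ _ =>
        Nat.cast_nonneg _

open Classical in
/-- At most `m` vertices have degree at least `x` when there are at most `m * x` half-edges. -/
lemma card_le_of_deg (s : Config N) {x m : ℝ} (hx : 0 < x) (p : Fin N → Prop)
    (hp : ∀ v, p v → x ≤ s.deg v) (hm : (s.totalDeg : ℝ) ≤ m * x) :
    ((Finset.univ.filter p).card : ℝ) ≤ m :=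
  le_of_mul_le_mul_right ((s.card_deg_gt p hp).trans hm) hx

/-- The number of vertices in state 1. -/
noncomputable def ones (s : Config N) : ℕ := (Finset.univ.filter fun v => s.opinion v = true).card

lemma ncard_ones (s : Config N) : ({v | s.opinion v = true} : Set (Fin N)).ncard = s.ones := by
  rw [ones, ← Set.ncard_coe_finset]; simp

end Config

/-! ### Smooth degree cutoffs -/

/-- The continuous piecewise linear function which is `0` up to `a` and `1` from `a + b` on. -/
noncomputable def ramp (a b x : ℝ) : ℝ := max 0 (min 1 ((x - a) / b))

section Ramp

variable {a b : ℝ}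

lemma ramp_nonneg (a b x : ℝ) : 0 ≤ ramp a b x := le_max_left _ _

lemma ramp_le_one (a b x : ℝ) : ramp a b x ≤ 1 := max_le zero_le_one (min_le_left _ _)

lemma ramp_mono (hb : 0 < b) {x y : ℝ} (h : x ≤ y) : ramp a b x ≤ ramp a b y := by
  unfold ramp
  gcongr

lemma ramp_add_le (hb : 0 < b) (x : ℝ) {t : ℝ} (ht : 0 ≤ t) :
    ramp a b (x + t) ≤ ramp a b x + t / b := by
  have h : (x + t - a) / b = (x - a) / b + t / b := by ring
  have ht' : 0 ≤ t / b := by positivity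
  unfold ramp
  rw [h]
  refine max_le (by positivity) ?_
  rcases le_total 1 ((x - a) / b) with h1 | h1
  · rw [min_eq_left h1]; exact (min_le_left _ _).trans (by simp [ht'])
  · rw [min_eq_right h1]
    exact (min_le_right _ _).trans (by linarith [le_max_right 0 ((x - a) / b)])

lemma ramp_eq_zero (hb : 0 < b) {x : ℝ} (h : x ≤ a) : ramp a b x = 0 := by
  unfold ramp
  have : (x - a) / b ≤ 0 := div_nonpos_of_nonpos_of_nonneg (by linarith) hb.le
  rw [min_eq_right (by linarith), max_eq_left this]

lemma ramp_eq_one (hb : 0 < b) {x : ℝ} (h : a + b ≤ x) : ramp a b x = 1 := by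
  unfold ramp
  have : 1 ≤ (x - a) / b := by rw [le_div_iff₀ hb]; linarith
  rw [min_eq_left this, max_eq_right zero_le_one]

lemma ramp_le_indicator (hb : 0 < b) (x : ℝ) : ramp a b x ≤ if a ≤ x then 1 else 0 := by
  split_ifs with h
  · exact ramp_le_one _ _ _
  · exact (ramp_eq_zero hb (not_le.1 h).le).le

/-- The discrete primitive of `ramp a b`. -/
noncomputable def rampSum (a b : ℝ) (d : ℕ) : ℝ := ∑ k ∈ Finset.range d, ramp a b k

lemma rampSum_succ (d : ℕ) : rampSum a b (d + 1) - rampSum a b d = ramp a b d := by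
  simp [rampSum, Finset.sum_range_succ]

/-- Losing a half-edge at degree `d` changes the primitive by the ramp at `d - 1`, which the
Lipschitz bound replaces by the ramp at `d` up to `1 / b`. -/
lemma rampSum_pred_mem (hb : 0 < b) {d : ℕ} (hd : 0 < d) :
    -ramp a b d ≤ rampSum a b (d - 1) - rampSum a b d ∧
      rampSum a b (d - 1) - rampSum a b d ≤ -ramp a b d + 1 / b := by
  obtain ⟨k, rfl⟩ : ∃ k, d = k + 1 := ⟨d - 1, by omega⟩
  have h := rampSum_succ (a := a) (b := b) k
  have h1 : ramp a b (k : ℝ) ≤ ramp a b ((k + 1 : ℕ) : ℝ) := ramp_mono hb (by push_cast; linarith)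
  have h2 := ramp_add_le (a := a) hb (k : ℝ) zero_le_one
  push_cast at h1 ⊢
  constructor <;> linarith

lemma rampSum_nonneg (a b : ℝ) (d : ℕ) : 0 ≤ rampSum a b d :=
  Finset.sum_nonneg fun _ _ => ramp_nonneg _ _ _

lemma rampSum_le (a b : ℝ) (d : ℕ) : rampSum a b d ≤ d := by
  calc rampSum a b d ≤ ∑ _k ∈ Finset.range d, (1 : ℝ) :=
        Finset.sum_le_sum fun _ _ => ramp_le_one _ _ _
    _ = d := by simp

lemma rampSum_le_max (hb : 0 < b) (d : ℕ) : rampSum a b d ≤ max 0 (d - a) := by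
  induction d with
  | zero => simp [rampSum]
  | succ d ih =>
    have h := rampSum_succ (a := a) (b := b) d
    rcases le_total (d : ℝ) a with h1 | h1
    · rw [ramp_eq_zero hb h1] at h
      rw [max_eq_left (by linarith)] at ih
      exact le_trans (by linarith) (le_max_left _ _)
    · rw [max_eq_right (by linarith)] at ih
      have := ramp_le_one a b d
      refine le_trans ?_ (le_max_right _ _)
      push_cast; linarith

end Ramp

namespace Config

variable {N : ℕ} {s : Config N} {v u z : Fin N}

/-! ### Perturbation of weighted edge counts -/

section PairSum

variable (s) (f g : Fin N → ℝ)

lemma pairSum_nonneg (hf : ∀ a, 0 ≤ f a) : 0 ≤ s.pairSum f :=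
  Finset.sum_nonneg fun a _ => Finset.sum_nonneg fun b _ =>
    mul_nonneg (s.adj_nonneg a b) (mul_nonneg (hf a) (hf b))

lemma pairSum_le_sq (hf : ∀ a, 0 ≤ f a) : s.pairSum f ≤ (∑ a, f a) ^ 2 := by
  rw [sq, Finset.sum_mul_sum]
  exact Finset.sum_le_sum fun a _ => Finset.sum_le_sum fun b _ =>
    mul_le_of_le_one_left (mul_nonneg (hf a) (hf b)) (s.adj_le_one a b)

lemma pairSum_le_totalDeg (hf : ∀ a, 0 ≤ f a) (hf1 : ∀ a, f a ≤ 1) :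
    s.pairSum f ≤ s.totalDeg := by
  have : (s.totalDeg : ℝ) = ∑ a, ∑ b, s.adj a b := by simp [totalDeg, sum_adj]
  rw [this]
  exact Finset.sum_le_sum fun a _ => Finset.sum_le_sum fun b _ =>
    mul_le_of_le_one_right (s.adj_nonneg a b) (mul_le_one₀ (hf1 a) (hf b) (hf1 b))

/-- By symmetry of the adjacency matrix the mixed terms of `(f - g) ⊗ (f + g)` cancel. -/
lemma pairSum_sub : s.pairSum f - s.pairSum g =
    ∑ a, (f a - g a) * ∑ b, s.adj a b * (f b + g b) := by
  have h1 : ∑ a, ∑ b, s.adj a b * (f a * g b) = ∑ a, ∑ b, s.adj a b * (g a * f b) := by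
    rw [Finset.sum_comm]
    refine Finset.sum_congr rfl fun a _ => Finset.sum_congr rfl fun b _ => ?_
    rw [s.adj_symm b a]; ring
  have h2 : ∑ a, (f a - g a) * ∑ b, s.adj a b * (f b + g b) = s.pairSum f - s.pairSum g +
      (∑ a, ∑ b, s.adj a b * (f a * g b) - ∑ a, ∑ b, s.adj a b * (g a * f b)) := by
    unfold pairSum
    simp only [Finset.mul_sum, ← Finset.sum_sub_distrib, ← Finset.sum_add_distrib]
    refine Finset.sum_congr rfl fun a _ => Finset.sum_congr rfl fun b _ => ?_
    ring
  rw [h2, h1]; ring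

lemma pairSum_sub_le (hf : ∀ a, 0 ≤ f a) (hf1 : ∀ a, f a ≤ 1) (hg : ∀ a, 0 ≤ g a)
    (hg1 : ∀ a, g a ≤ 1) : s.pairSum f - s.pairSum g ≤ 2 * ∑ a, max 0 (f a - g a) * s.deg a := by
  rw [pairSum_sub, Finset.mul_sum]
  refine Finset.sum_le_sum fun a _ => ?_
  have h0 : 0 ≤ ∑ b, s.adj a b * (f b + g b) :=
    Finset.sum_nonneg fun b _ => mul_nonneg (s.adj_nonneg a b) (add_nonneg (hf b) (hg b))
  have h1 : ∑ b, s.adj a b * (f b + g b) ≤ 2 * s.deg a := by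
    rw [← sum_adj, Finset.mul_sum]
    refine Finset.sum_le_sum fun b _ => ?_
    have := s.adj_nonneg a b
    nlinarith [hf1 b, hg1 b]
  calc (f a - g a) * ∑ b, s.adj a b * (f b + g b)
      ≤ max 0 (f a - g a) * ∑ b, s.adj a b * (f b + g b) :=
        mul_le_mul_of_nonneg_right (le_max_right _ _) h0
    _ ≤ max 0 (f a - g a) * (2 * s.deg a) := mul_le_mul_of_nonneg_left h1 (le_max_left _ _)
    _ = _ := by ring

lemma pairSum_mono (hg : ∀ a, 0 ≤ g a) (h : ∀ a, g a ≤ f a) : s.pairSum g ≤ s.pairSum f :=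
  Finset.sum_le_sum fun a _ => Finset.sum_le_sum fun b _ =>
    mul_le_mul_of_nonneg_left (mul_le_mul (h a) (h b) (hg b) ((hg a).trans (h a)))
      (s.adj_nonneg a b)

/-- Degrees do not appear here: entries of the adjacency matrix are bounded by `1`. This suits
weights carried by a few vertices of huge degree, for which `pairSum_sub_le` would be too weak. -/
lemma abs_pairSum_sub_le (hf : ∀ a, 0 ≤ f a) (hg : ∀ a, 0 ≤ g a) :
    |s.pairSum f - s.pairSum g| ≤ (∑ a, |f a - g a|) * (∑ b, f b + ∑ b, g b) := by
  rw [pairSum_sub, Finset.sum_mul]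
  refine (Finset.abs_sum_le_sum_abs _ _).trans (Finset.sum_le_sum fun a _ => ?_)
  rw [abs_mul]
  refine mul_le_mul_of_nonneg_left ?_ (abs_nonneg _)
  rw [abs_of_nonneg (Finset.sum_nonneg fun b _ =>
    mul_nonneg (s.adj_nonneg a b) (add_nonneg (hf b) (hg b))), ← Finset.sum_add_distrib]
  exact Finset.sum_le_sum fun b _ =>
    mul_le_of_le_one_left (add_nonneg (hf b) (hg b)) (s.adj_le_one a b)

end PairSum

/-- Sums over all vertices of a function vanishing off two of them. -/
lemma sum_eq_pair {F : Fin N → ℝ} (huz : u ≠ z) (h : ∀ a, a ≠ u → a ≠ z → F a = 0) :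
    ∑ a, F a = F u + F z := by
  rw [← Finset.sum_subset (Finset.subset_univ {u, z}), Finset.sum_pair huz]
  intro a _ ha
  simp only [Finset.mem_insert, Finset.mem_singleton, not_or] at ha
  exact h a ha.1 ha.2

/-! ### The hub potential -/

/-- The potential which controls the number of updates with a root of nearly full degree. -/
noncomputable def hubPotential (s : Config N) (a b : ℝ) : ℝ :=
  ∑ w, rampSum a b (s.deg w) - s.pairSum (fun w => ramp a b (s.deg w)) / 2

section HubPotential

variable {a b c : ℝ}

/-- Write `f` for the ramp of the degree. The first sum changes by about `-f u + f z`, and half the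
pair sum, at frozen weights, by `-f v * f u + f v * f z`; the difference factors through `1 - f v`.
The weights of `u` and `z` move by at most `1 / b` each against a total weight of at most `c`, which
gives the error. -/
lemma hubPotential_moveEdge (hb : 0 < b) (h : s.graph.Adj v u) (hz : z ∈ s.targets v)
    (hc : ∑ w, ramp a b (s.deg w) ≤ c)
    (hc' : ∑ w, ramp a b ((s.moveEdge v u z).deg w) ≤ c) :
    |(s.moveEdge v u z).hubPotential a b - s.hubPotential a b -
      (-(1 - ramp a b (s.deg v)) * ramp a b (s.deg u) +
        (1 - ramp a b (s.deg v)) * ramp a b (s.deg z))| ≤ (1 + 2 * c) / b := by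
  set s' := s.moveEdge v u z
  have huz := ne_of_mem_targets h hz
  set f : Fin N → ℝ := fun w => ramp a b (s.deg w)
  set f' : Fin N → ℝ := fun w => ramp a b (s'.deg w)
  have e1 := sum_moveEdge_sub h hz fun _ d => rampSum a b d
  rw [rampSum_succ] at e1
  have e2 := pairSum_moveEdge h hz f
  have e3 := rampSum_pred_mem (a := a) hb (deg_pos_of_adj h)
  have e4 := s'.abs_pairSum_sub_le f' f (fun _ => ramp_nonneg _ _ _) (fun _ => ramp_nonneg _ _ _)
  have e5 : ∑ w, |f' w - f w| ≤ 2 / b := by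
    rw [sum_eq_pair huz]
    · have h1 : |f' u - f u| ≤ 1 / b := by
        have hd := moveEdge_deg_left h hz
        have : (s.deg u : ℝ) = s'.deg u + 1 := by exact_mod_cast hd.symm
        simp only [f, f', this]
        have h1 := ramp_add_le (a := a) hb (s'.deg u : ℝ) zero_le_one
        have h2 := ramp_mono (a := a) hb (show (s'.deg u : ℝ) ≤ s'.deg u + 1 by linarith)
        rw [abs_le]; constructor <;> linarith
      have h2 : |f' z - f z| ≤ 1 / b := by
        have hd := moveEdge_deg_target h hz
        have : (s'.deg z : ℝ) = s.deg z + 1 := by exact_mod_cast hd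
        simp only [f, f', this]
        have h1 := ramp_add_le (a := a) hb (s.deg z : ℝ) zero_le_one
        have h2 := ramp_mono (a := a) hb (show (s.deg z : ℝ) ≤ s.deg z + 1 by linarith)
        have h3 : 0 < 1 / b := by positivity
        rw [abs_le]; constructor <;> linarith
      calc _ ≤ 1 / b + 1 / b := add_le_add h1 h2
        _ = 2 / b := by ring
    · intro w h1 h2
      simp only [f, f', s', moveEdge_deg_of_ne h hz h1 h2, sub_self, abs_zero]
  have e6 : |s'.pairSum f' - s'.pairSum f| ≤ 2 / b * (2 * c) := by
    refine e4.trans (mul_le_mul e5 (by linarith) ?_ (by positivity))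
    exact add_nonneg (Finset.sum_nonneg fun _ _ => ramp_nonneg _ _ _)
      (Finset.sum_nonneg fun _ _ => ramp_nonneg _ _ _)
  have e7 : (1 + 2 * c) / b = 1 / b + 2 / b * (2 * c) / 2 := by ring
  have e8 : s'.hubPotential a b - s.hubPotential a b =
      (∑ w, rampSum a b (s'.deg w) - ∑ w, rampSum a b (s.deg w)) -
        (s'.pairSum f' - s.pairSum f) / 2 := by
    simp only [hubPotential, f, f']; ring
  have hpos : 0 < 1 / b := by positivity
  rw [e8, e1, e7]
  rw [abs_le] at e6 ⊢
  simp only [f, f'] at e2 e6 ⊢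
  constructor <;> linarith

open Classical in
-- Only vertices above the threshold `a` contribute, each at most `N - a`. With `a` close to `N`
-- this stays small even after multiplication by a large constant.
lemma hubPotential_le (hb : 0 < b) {m x : ℝ} (hx : 0 ≤ x)
    (hm : ((Finset.univ.filter fun w => a ≤ (s.deg w : ℝ)).card : ℝ) ≤ m)
    (hN : (N : ℝ) ≤ a + x) : s.hubPotential a b ≤ m * x := by
  have h1 : ∑ w, rampSum a b (s.deg w) ≤ ∑ w, if a ≤ (s.deg w : ℝ) then x else 0 := by
    refine Finset.sum_le_sum fun w _ => (rampSum_le_max hb _).trans ?_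
    have : (s.deg w : ℝ) ≤ N := by exact_mod_cast (s.deg_lt w).le
    split_ifs with h
    · exact max_le hx (by linarith)
    · exact max_le le_rfl (by linarith)
  rw [← Finset.sum_filter, Finset.sum_const, nsmul_eq_mul] at h1
  have h3 := s.pairSum_nonneg (fun w => ramp a b (s.deg w)) fun w => ramp_nonneg _ _ _
  unfold hubPotential
  have := mul_le_mul_of_nonneg_right hm hx
  linarith

lemma neg_sq_le_hubPotential (hc : ∑ w, ramp a b (s.deg w) ≤ c) :
    -(c ^ 2 / 2) ≤ s.hubPotential a b := by
  have h1 : 0 ≤ ∑ w, rampSum a b (s.deg w) := Finset.sum_nonneg fun w _ => rampSum_nonneg _ _ _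
  have h2 := s.pairSum_le_sq (fun w => ramp a b (s.deg w)) fun w => ramp_nonneg _ _ _
  have h3 : 0 ≤ ∑ w, ramp a b (s.deg w) := Finset.sum_nonneg fun w _ => ramp_nonneg _ _ _
  have h4 := pow_le_pow_left₀ h3 hc 2
  unfold hubPotential
  linarith

end HubPotential

/-! ### The edge potential -/

/-- Weight of a vertex in the count of edges between low-degree vertices in state `0`. -/
noncomputable def lowZero (s : Config N) (x : ℝ) (w : Fin N) : ℝ :=
  if s.opinion w = true then 0 else 1 - ramp x x (s.deg w)

/-- The potential which trades the half-edges at vertices of large degree against the edges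
between low-degree vertices in state `0`. -/
noncomputable def edgePotential (s : Config N) (x : ℝ) : ℝ :=
  ∑ w, rampSum x x (s.deg w) - s.pairSum (s.lowZero x) / 2

lemma lowZero_nonneg (x : ℝ) (w : Fin N) : 0 ≤ s.lowZero x w := by
  unfold lowZero; split_ifs
  · exact le_rfl
  · linarith [ramp_le_one x x (s.deg w)]

lemma lowZero_le_one (x : ℝ) (w : Fin N) : s.lowZero x w ≤ 1 := by
  unfold lowZero; split_ifs
  · exact zero_le_one
  · linarith [ramp_nonneg x x (s.deg w)]

lemma edgePotential_le (x : ℝ) : s.edgePotential x ≤ s.totalDeg := by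
  have h1 : ∑ w, rampSum x x (s.deg w) ≤ ∑ w, (s.deg w : ℝ) :=
    Finset.sum_le_sum fun w _ => rampSum_le _ _ _
  have h2 := s.pairSum_nonneg (s.lowZero x) (lowZero_nonneg x)
  unfold edgePotential totalDeg
  push_cast; linarith

lemma le_edgePotential (x : ℝ) : -(s.totalDeg : ℝ) / 2 ≤ s.edgePotential x := by
  have h1 : 0 ≤ ∑ w, rampSum x x (s.deg w) := Finset.sum_nonneg fun w _ => rampSum_nonneg _ _ _
  have h2 := s.pairSum_le_totalDeg (s.lowZero x) (lowZero_nonneg x) (lowZero_le_one x)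
  unfold edgePotential; linarith

section EdgePotential

variable {x : ℝ}

lemma lowZero_mul_eq_zero (h : s.opinion v ≠ s.opinion u) : s.lowZero x v * s.lowZero x u = 0 := by
  unfold lowZero
  cases hv : s.opinion v <;> cases hu : s.opinion u <;> simp_all

lemma lowZero_imitate_of_ne {w : Fin N} (h : w ≠ v) :
    (s.imitate v u).lowZero x w = s.lowZero x w := by
  have h1 : (s.imitate v u).opinion w = s.opinion w := Function.update_of_ne h _ _
  unfold lowZero
  rw [imitate_deg]
  simp only [h1]

lemma lowZero_moveEdge (w : Fin N) : (s.moveEdge v u z).lowZero x w =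
    if s.opinion w = true then 0 else 1 - ramp x x ((s.moveEdge v u z).deg w) := rfl

/-- Small multiples of the degree where a ramp is not yet `1`. -/
lemma one_sub_ramp_mul_le (hx : 0 < x) (d : ℝ) (hd : 0 ≤ d) :
    (1 - ramp x x d) * d ≤ if d < 2 * x then 2 * x else 0 := by
  split_ifs with h
  · have := ramp_nonneg x x d
    nlinarith
  · rw [ramp_eq_one hx (by linarith)]; simp

/-- Only a zero turning into a one can raise the potential, by uncounting edges at `v`; there are at
most `deg v` of them, weighted by a factor that vanishes from degree `2 x` on. -/
lemma edgePotential_imitate_le (hx : 0 < x) (h : s.opinion v ≠ s.opinion u) :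
    (s.imitate v u).edgePotential x - s.edgePotential x ≤
      if s.opinion v = true then 0 else if (s.deg v : ℝ) < 2 * x then 2 * x else 0 := by
  have e : (s.imitate v u).edgePotential x - s.edgePotential x =
      (s.pairSum (s.lowZero x) - s.pairSum ((s.imitate v u).lowZero x)) / 2 := by
    have : (s.imitate v u).pairSum ((s.imitate v u).lowZero x) =
      s.pairSum ((s.imitate v u).lowZero x) := rfl
    simp only [edgePotential, imitate_deg, this]; ring
  rw [e]
  split_ifs with h1 h2
  · have := s.pairSum_mono ((s.imitate v u).lowZero x) (s.lowZero x) (lowZero_nonneg x) fun a => by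
      by_cases ha : a = v
      · subst ha
        have : s.lowZero x a = 0 := by simp [lowZero, h1]
        rw [this]; exact lowZero_nonneg _ _
      · rw [lowZero_imitate_of_ne ha]
    linarith
  all_goals
    have hk := s.pairSum_sub_le (s.lowZero x) ((s.imitate v u).lowZero x) (lowZero_nonneg x)
      (lowZero_le_one x) (lowZero_nonneg x) (lowZero_le_one x)
    rw [Finset.sum_eq_single v (fun a _ ha => by rw [lowZero_imitate_of_ne ha]; simp)
      (by simp)] at hk
    have hu : s.opinion u = true := by
      cases hu : s.opinion u
      · simp_all
      · rfl
    have e1 : (s.imitate v u).lowZero x v = 0 := by simp [lowZero, imitate, hu]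
    have e2 : s.lowZero x v = 1 - ramp x x (s.deg v) := by simp [lowZero, h1]
    have e3 := lowZero_nonneg (s := s) x v
    rw [e1, sub_zero, max_eq_right e3, e2] at hk
    have := one_sub_ramp_mul_le hx (s.deg v) (Nat.cast_nonneg _)
    simp only [h2, if_true, if_false] at this
    linarith

lemma abs_edgePotential_imitate_le (hx : 0 < x) (h : s.opinion v ≠ s.opinion u) :
    |(s.imitate v u).edgePotential x - s.edgePotential x| ≤ 2 * x := by
  have hu := edgePotential_imitate_le hx h
  have hup : (s.imitate v u).edgePotential x - s.edgePotential x ≤ 2 * x :=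
    hu.trans (by split_ifs <;> linarith)
  have hback : (s.imitate v u).imitate v v = s.imitate v u := by
    ext1 <;> simp [imitate]
  set t := s.imitate v u
  have e : s.edgePotential x - t.edgePotential x =
      (s.pairSum (t.lowZero x) - s.pairSum (s.lowZero x)) / 2 := by
    have : t.pairSum (t.lowZero x) = s.pairSum (t.lowZero x) := rfl
    simp only [edgePotential, this, t, imitate_deg]; ring
  have hk := s.pairSum_sub_le (t.lowZero x) (s.lowZero x) (lowZero_nonneg x)
      (lowZero_le_one x) (lowZero_nonneg x) (lowZero_le_one x)
  rw [Finset.sum_eq_single v (fun a _ ha => by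
      rw [show t.lowZero x a = s.lowZero x a from lowZero_imitate_of_ne ha]; simp) (by simp)] at hk
  have h1 : max 0 (t.lowZero x v - s.lowZero x v) ≤ 1 - ramp x x (s.deg v) := by
    refine max_le (by linarith [ramp_le_one x x (s.deg v)]) ?_
    have h3 := lowZero_nonneg (s := s) x v
    have : t.lowZero x v ≤ 1 - ramp x x (s.deg v) := by
      have hd : t.deg v = s.deg v := rfl
      unfold lowZero; rw [hd]; split_ifs
      · linarith [ramp_le_one x x (s.deg v)]
      · exact le_rfl
    linarith
  have h2 := one_sub_ramp_mul_le hx (s.deg v) (Nat.cast_nonneg _)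
  have h3 : (if (s.deg v : ℝ) < 2 * x then 2 * x else 0) ≤ 2 * x := by split_ifs <;> linarith
  have h4 := mul_le_mul_of_nonneg_right h1 (Nat.cast_nonneg (α := ℝ) (s.deg v))
  rw [abs_le]
  constructor <;> linarith

/-- The increment of `lowZero` when a degree grows by one, weighted by the degree. -/
lemma ramp_succ_sub_mul_le (hx : 2 ≤ x) (d : ℕ) :
    (ramp x x ((d : ℝ) + 1) - ramp x x d) * (d + 1) ≤ if x / 2 ≤ (d : ℝ) then 3 else 0 := by
  have hx0 : 0 < x := by linarith
  split_ifs with h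
  · rcases le_total (2 * x) (d : ℝ) with h1 | h1
    · rw [ramp_eq_one hx0 (by linarith), ramp_eq_one hx0 (by linarith)]; simp
    · have h2 := ramp_add_le (a := x) hx0 (d : ℝ) zero_le_one
      have h3 : (ramp x x ((d : ℝ) + 1) - ramp x x d) * (d + 1) ≤ 1 / x * (2 * x + 1) :=
        mul_le_mul (by linarith) (by linarith) (by positivity) (by positivity)
      have h4 : 1 / x * (2 * x + 1) = 2 + 1 / x := by field_simp
      have h5 : 1 / x ≤ 1 := by rw [div_le_one hx0]; linarith
      linarith
  · rw [ramp_eq_zero hx0 (by linarith), ramp_eq_zero hx0 (by linarith)]; simp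

/-- A discordant edge has weight zero in the pair sum, so removing it costs nothing there. Losing a
half-edge at `u` gains its ramp up to `1 / x`, and the new edge gains `lowZero v` when `z` is a
light zero. If `z` has degree at least `x / 2`, the loss is at most `5 = 1 + 3 + 1`: its ramp, the
reweighting of its edges, and the missing weight of the new edge. -/
lemma edgePotential_moveEdge (hx : 2 ≤ x) (h : s.graph.Adj v u) (ho : s.opinion v ≠ s.opinion u)
    (hz : z ∈ s.targets v) :
    (s.moveEdge v u z).edgePotential x - s.edgePotential x ≤
      -ramp x x (s.deg u) - s.lowZero x v + (if s.opinion z = true then 1 else 0) +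
        5 * (if x / 2 ≤ (s.deg z : ℝ) then 1 else 0) + 1 / x ∧
    |(s.moveEdge v u z).edgePotential x - s.edgePotential x| ≤ 9 := by
  have hx0 : 0 < x := by linarith
  set s' := s.moveEdge v u z
  have huz := ne_of_mem_targets h hz
  have hdu := moveEdge_deg_left h hz
  have hdz := moveEdge_deg_target h hz
  have hduR : (s.deg u : ℝ) = s'.deg u + 1 := by exact_mod_cast hdu.symm
  have hdzR : (s'.deg z : ℝ) = s.deg z + 1 := by exact_mod_cast hdz
  have e1 := sum_moveEdge_sub h hz fun _ d => rampSum x x d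
  rw [rampSum_succ] at e1
  have e2 := pairSum_moveEdge h hz (s.lowZero x)
  rw [lowZero_mul_eq_zero ho] at e2
  have e3 := rampSum_pred_mem (a := x) hx0 (deg_pos_of_adj h)
  have hoff : ∀ a, a ≠ u → a ≠ z → s'.lowZero x a = s.lowZero x a := fun a h1 h2 => by
    simp only [s', lowZero_moveEdge]
    simp only [lowZero, moveEdge_deg_of_ne h hz h1 h2]
  have hzle : s'.lowZero x z ≤ s.lowZero x z := by
    simp only [s', lowZero_moveEdge]
    simp only [lowZero]
    split_ifs
    · exact le_rfl
    · have := ramp_mono (a := x) hx0 (show (s.deg z : ℝ) ≤ s'.deg z by rw [hdzR]; linarith)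
      simp only [s'] at this; linarith
  have hule : s.lowZero x u ≤ s'.lowZero x u := by
    simp only [s', lowZero_moveEdge]
    simp only [lowZero]
    split_ifs
    · exact le_rfl
    · have := ramp_mono (a := x) hx0 (show (s'.deg u : ℝ) ≤ s.deg u by rw [hduR]; linarith)
      simp only [s'] at this; linarith
  set I : ℝ := if x / 2 ≤ (s.deg z : ℝ) then 1 else 0
  have hI : (if x / 2 ≤ (s.deg z : ℝ) then (3 : ℝ) else 0) = 3 * I := by
    simp only [I]; split_ifs <;> norm_num
  have hI0 : 0 ≤ I := by simp only [I]; split_ifs <;> norm_num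
  have hI1 : I ≤ 1 := by simp only [I]; split_ifs <;> norm_num
  have e4 : s'.pairSum (s.lowZero x) - s'.pairSum (s'.lowZero x) ≤ 2 * (3 * I) := by
    refine (s'.pairSum_sub_le _ _ (lowZero_nonneg x) (lowZero_le_one x) (lowZero_nonneg x)
      (lowZero_le_one x)).trans ?_
    rw [sum_eq_pair huz (fun a h1 h2 => by rw [hoff a h1 h2]; simp),
      max_eq_left (by linarith), max_eq_right (by linarith)]
    have : (s.lowZero x z - s'.lowZero x z) * s'.deg z ≤ 3 * I := by
      rw [← hI]
      refine le_trans ?_ (ramp_succ_sub_mul_le hx (s.deg z))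
      rw [hdzR]
      refine mul_le_mul_of_nonneg_right ?_ (by positivity)
      have hm := ramp_mono (a := x) hx0 (show (s.deg z : ℝ) ≤ s.deg z + 1 by linarith)
      have hdzR' : ((s.moveEdge v u z).deg z : ℝ) = s.deg z + 1 := hdzR
      rw [lowZero_moveEdge]
      simp only [lowZero, hdzR']
      split_ifs <;> linarith
    linarith
  have e5 : s'.pairSum (s'.lowZero x) - s'.pairSum (s.lowZero x) ≤ 2 * 3 := by
    refine (s'.pairSum_sub_le _ _ (lowZero_nonneg x) (lowZero_le_one x) (lowZero_nonneg x)
      (lowZero_le_one x)).trans ?_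
    rw [sum_eq_pair huz (fun a h1 h2 => by rw [hoff a h1 h2]; simp),
      max_eq_left (a := (0 : ℝ)) (b := s'.lowZero x z - s.lowZero x z) (by linarith),
      max_eq_right (by linarith)]
    have h1 : (s'.lowZero x u - s.lowZero x u) * s'.deg u ≤ 3 := by
      have h2 := ramp_succ_sub_mul_le hx (s'.deg u)
      have hm := ramp_mono (a := x) hx0 (show (s'.deg u : ℝ) ≤ s'.deg u + 1 by linarith)
      have h3 : (s'.lowZero x u - s.lowZero x u) * s'.deg u ≤
          (ramp x x ((s'.deg u : ℝ) + 1) - ramp x x (s'.deg u)) * (s'.deg u + 1) := by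
        refine mul_le_mul ?_ (by linarith) (by positivity) (by linarith)
        rw [lowZero_moveEdge]
        simp only [lowZero, hduR]
        split_ifs <;> linarith
      refine (h3.trans h2).trans ?_
      split_ifs <;> norm_num
    linarith
  have e6 : s'.edgePotential x - s.edgePotential x =
      (∑ w, rampSum x x (s'.deg w) - ∑ w, rampSum x x (s.deg w)) -
        (s'.pairSum (s'.lowZero x) - s.pairSum (s.lowZero x)) / 2 := by
    simp only [edgePotential]; ring
  have hk : ramp x x (s.deg z) ≤ I := by
    simp only [I]
    split_ifs with h1
    · exact ramp_le_one _ _ _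
    · exact (ramp_eq_zero hx0 (by linarith)).le
  have hmz : 1 - (if s.opinion z = true then (1 : ℝ) else 0) - I ≤ s.lowZero x z := by
    simp only [lowZero]
    split_ifs <;> linarith
  have hv0 := lowZero_nonneg (s := s) x v
  have hv1 := lowZero_le_one (s := s) x v
  have hz0 := lowZero_nonneg (s := s) x z
  have hz1 := lowZero_le_one (s := s) x z
  have hJ0 : 0 ≤ (if s.opinion z = true then (1 : ℝ) else 0) := by split_ifs <;> norm_num
  have hvz0 := mul_nonneg hv0 hz0
  have hvz1 := mul_le_one₀ hv1 hz0 hz1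
  have hvz : s.lowZero x v - (if s.opinion z = true then (1 : ℝ) else 0) - I ≤
      s.lowZero x v * s.lowZero x z := by
    nlinarith [mul_le_mul_of_nonneg_left hmz hv0]
  have hk0 := ramp_nonneg x x (s.deg z)
  have hk1 := ramp_le_one x x (s.deg z)
  have hk0' := ramp_nonneg x x (s.deg u)
  have hk1' := ramp_le_one x x (s.deg u)
  have hxx : 1 / x ≤ 1 := by rw [div_le_one hx0]; linarith
  rw [e6, e1]
  refine ⟨by linarith, ?_⟩
  rw [abs_le]
  constructor <;> linarith

end EdgePotential

/-! ### The weighted count of ones -/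

/-- The sum over the vertices in state `1` of `r ^ degree`. -/
noncomputable def onesPotential (s : Config N) (r : ℝ) : ℝ :=
  ∑ w, if s.opinion w = true then r ^ s.deg w else 0

section OnesPotential

variable {r : ℝ}

lemma onesPotential_nonneg (hr : 0 ≤ r) : 0 ≤ s.onesPotential r :=
  Finset.sum_nonneg fun w _ => by split_ifs <;> positivity

lemma onesPotential_le (hr : 0 ≤ r) (hr1 : r ≤ 1) : s.onesPotential r ≤ s.ones := by
  have : (s.ones : ℝ) = ∑ w, if s.opinion w = true then (1 : ℝ) else 0 := by simp [ones]
  rw [this]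
  refine Finset.sum_le_sum fun w _ => ?_
  split_ifs
  · exact pow_le_one₀ hr hr1
  · exact le_rfl

lemma sum_imitate_sub (F : Fin N → Bool → ℝ) :
    ∑ w, F w ((s.imitate v u).opinion w) - ∑ w, F w (s.opinion w) =
      F v (s.opinion u) - F v (s.opinion v) := by
  rw [← Finset.sum_sub_distrib, Finset.sum_eq_single v]
  · simp [imitate]
  · intro w _ hw
    simp [imitate, Function.update_of_ne hw]
  · simp

lemma onesPotential_imitate (h : s.opinion v ≠ s.opinion u) :
    (s.imitate v u).onesPotential r - s.onesPotential r =
      if s.opinion v = true then -r ^ s.deg v else r ^ s.deg v := by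
  have := sum_imitate_sub (s := s) (v := v) (u := u) fun w o => if o = true then r ^ s.deg w else 0
  simp only [onesPotential, imitate_deg]
  rw [this]
  cases hv : s.opinion v <;> cases hu : s.opinion u <;> simp_all

lemma onesPotential_moveEdge (hr : 0 ≤ r) (hr1 : r ≤ 1) (h : s.graph.Adj v u)
    (hz : z ∈ s.targets v) :
    (1 - r) * (if s.opinion u = true then r ^ (s.deg u - 1) else 0) -
        (1 - r) * (if s.opinion z = true then 1 else 0) ≤
      (s.moveEdge v u z).onesPotential r - s.onesPotential r ∧
    |(s.moveEdge v u z).onesPotential r - s.onesPotential r| ≤ 1 - r := by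
  have e := sum_moveEdge_sub h hz fun w d => if s.opinion w = true then r ^ d else 0
  have e' : (s.moveEdge v u z).onesPotential r =
    ∑ w, if s.opinion w = true then r ^ (s.moveEdge v u z).deg w else 0 := rfl
  rw [e', onesPotential, e]
  obtain ⟨d, hd⟩ : ∃ d, s.deg u = d + 1 := ⟨s.deg u - 1, by have := deg_pos_of_adj h; omega⟩
  rw [hd, Nat.add_sub_cancel]
  have p1 : 0 ≤ r ^ d := by positivity
  have p2 : r ^ d ≤ 1 := pow_le_one₀ hr hr1
  have p3 : 0 ≤ r ^ s.deg z := by positivity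
  have p4 : r ^ s.deg z ≤ 1 := pow_le_one₀ hr hr1
  have q0 : 0 ≤ 1 - r := by linarith
  have a1 : r ^ d - r ^ (d + 1) = (1 - r) * r ^ d := by ring
  have a2 : r ^ s.deg z - r ^ (s.deg z + 1) = (1 - r) * r ^ s.deg z := by ring
  have a3 : r ^ (d + 1) ≤ r ^ d := pow_le_pow_of_le_one hr hr1 (by omega)
  have b1 := mul_le_mul_of_nonneg_left p2 q0
  have b2 := mul_le_mul_of_nonneg_left p4 q0
  have b3 := mul_le_mul_of_nonneg_left a3 q0
  have b4 := mul_nonneg q0 p1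
  have b5 := mul_nonneg q0 p3
  constructor
  · split_ifs <;> linarith
  · rw [abs_le]
    split_ifs <;> constructor <;> linarith

lemma ones_imitate (h : s.opinion v ≠ s.opinion u) :
    ((s.imitate v u).ones : ℝ) - s.ones = if s.opinion v = true then -1 else 1 := by
  have := onesPotential_imitate (r := 1) h
  simpa [onesPotential, ones] using this

lemma ones_moveEdge (v u z : Fin N) : (s.moveEdge v u z).ones = s.ones := rfl

end OnesPotential

end Config

/-! ### Rarity of vertices of nearly full degree -/

namespace Config

variable {N : ℕ} {s : Config N} {ℓ η ρ K q : ℝ}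

open Classical in
/-- The indicator that a vertex has degree at least `(1 - η) N`. -/
noncomputable def full (s : Config N) (η : ℝ) (v : Fin N) : ℝ :=
  if (1 - η) * N ≤ s.deg v then 1 else 0

lemma full_nonneg (η : ℝ) (v : Fin N) : 0 ≤ s.full η v := by
  unfold full; split_ifs <;> norm_num

open Classical in
lemma card_deg_ge_le {x m : ℝ} (hx : 0 < x) (hs : (s.totalDeg : ℝ) = N * ℓ) (hm : N * ℓ ≤ m * x) :
    ((Finset.univ.filter fun w => x ≤ (s.deg w : ℝ)).card : ℝ) ≤ m :=
  s.card_le_of_deg hx _ (fun _ h => h) (hs.le.trans hm)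

lemma sum_ramp_le {a b : ℝ} (hb : 0 < b) (hN : 0 < N) (ha : (N : ℝ) / 2 ≤ a) (hℓ : 0 ≤ ℓ)
    (hs : (s.totalDeg : ℝ) = N * ℓ) : ∑ w, ramp a b (s.deg w) ≤ 2 * ℓ := by
  classical
  have hN' : (0 : ℝ) < N := by exact_mod_cast hN
  calc ∑ w, ramp a b (s.deg w) ≤ ∑ w, if a ≤ (s.deg w : ℝ) then (1 : ℝ) else 0 :=
        Finset.sum_le_sum fun w _ => ramp_le_indicator hb _
    _ = ((Finset.univ.filter fun w => a ≤ (s.deg w : ℝ)).card : ℝ) := by simp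
    _ ≤ 2 * ℓ := card_deg_ge_le (by linarith) hs (by nlinarith)

/-- Two vertices of degree at least `3N/4` and of different states have many common neighbours,
each of which is in conflict with one of them. -/
lemma card_mul_card_le (hN : 0 < N) (hℓ : 0 ≤ ℓ) (hs : (s.totalDeg : ℝ) = N * ℓ)
    (A B : Finset (Fin N)) (hA : ∀ v ∈ A, s.opinion v = false ∧ 3 / 4 * (N : ℝ) ≤ s.deg v)
    (hB : ∀ v ∈ B, s.opinion v = true ∧ 3 / 4 * (N : ℝ) ≤ s.deg v) :
    (A.card : ℝ) * B.card * N ≤ 4 * ℓ * s.discordant.card := by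
  classical
  have hN' : (0 : ℝ) < N := by exact_mod_cast hN
  have hcard : ∀ C : Finset (Fin N), (∀ v ∈ C, 3 / 4 * (N : ℝ) ≤ s.deg v) → (C.card : ℝ) ≤ 2 * ℓ := by
    intro C hC
    have := s.card_le_of_deg (x := 3 / 4 * (N : ℝ)) (m := 2 * ℓ) (by positivity) (· ∈ C) hC
      (by rw [hs]; nlinarith [mul_nonneg hN'.le hℓ])
    simpa using this
  have hA' := hcard A fun v hv => (hA v hv).2
  have hB' := hcard B fun v hv => (hB v hv).2
  -- Double counting of triples `(x, y, w)` with `w` a common neighbour: two degrees of at least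
  -- `3N/4` overlap in at least `N/2` vertices.
  have low : (A.card : ℝ) * B.card * (N / 2) ≤ ∑ x ∈ A, ∑ y ∈ B, ∑ w, s.adj x w * s.adj y w := by
    have : (A.card : ℝ) * B.card * (N / 2) = ∑ x ∈ A, ∑ y ∈ B, (N : ℝ) / 2 := by
      simp only [Finset.sum_const, nsmul_eq_mul]; ring
    rw [this]
    refine Finset.sum_le_sum fun x hx => Finset.sum_le_sum fun y hy => ?_
    have h1 : ∑ w, (s.adj x w + s.adj y w - 1) ≤ ∑ w, s.adj x w * s.adj y w := by
      refine Finset.sum_le_sum fun w _ => ?_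
      nlinarith [s.adj_le_one x w, s.adj_le_one y w]
    rw [Finset.sum_sub_distrib, Finset.sum_add_distrib, sum_adj, sum_adj] at h1
    simp only [Finset.sum_const, Finset.card_univ, Fintype.card_fin, nsmul_eq_mul, mul_one] at h1
    linarith [(hA x hx).2, (hB y hy).2]
  -- Whatever its state, `w` disagrees with all of `A` or all of `B`. That factor counts discordant
  -- edges at `w`; the other is at most `2 ℓ`.
  have up : ∑ x ∈ A, ∑ y ∈ B, ∑ w, s.adj x w * s.adj y w ≤
      ∑ w, 2 * ℓ * ∑ x, if (x, w) ∈ s.discordant then (1 : ℝ) else 0 := by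
    have : ∑ x ∈ A, ∑ y ∈ B, ∑ w, s.adj x w * s.adj y w =
        ∑ w, (∑ x ∈ A, s.adj x w) * ∑ y ∈ B, s.adj y w := by
      simp only [Finset.sum_mul_sum]
      conv_rhs => rw [Finset.sum_comm]
      refine Finset.sum_congr rfl fun x _ => ?_
      rw [Finset.sum_comm]
    rw [this]
    have hdisc : ∀ (C : Finset (Fin N)) (w : Fin N), (∀ x ∈ C, s.opinion x ≠ s.opinion w) →
        ∑ x ∈ C, s.adj x w ≤ ∑ x, if (x, w) ∈ s.discordant then (1 : ℝ) else 0 := by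
      intro C w hC
      calc ∑ x ∈ C, s.adj x w ≤ ∑ x ∈ C, if (x, w) ∈ s.discordant then (1 : ℝ) else 0 := by
            refine Finset.sum_le_sum fun x hx => ?_
            have := hC x hx
            simp [adj, mem_discordant, this]
        _ ≤ _ := Finset.sum_le_sum_of_subset_of_nonneg (Finset.subset_univ _) fun _ _ _ => by
            split_ifs <;> norm_num
    have hle : ∀ (C : Finset (Fin N)) (w : Fin N), ∑ x ∈ C, s.adj x w ≤ C.card := by
      intro C w
      simpa using Finset.sum_le_sum fun x (_ : x ∈ C) => s.adj_le_one x w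
    have hnn : ∀ (C : Finset (Fin N)) (w : Fin N), 0 ≤ ∑ x ∈ C, s.adj x w := fun C w =>
      Finset.sum_nonneg fun x _ => s.adj_nonneg x w
    refine Finset.sum_le_sum fun w _ => ?_
    cases hw : s.opinion w
    · have h1 := hdisc B w fun x hx => by rw [hw, (hB x hx).1]; simp
      exact mul_le_mul ((hle A w).trans hA') h1 (hnn B w) (by linarith)
    · have h1 := hdisc A w fun x hx => by rw [hw, (hA x hx).1]; simp
      rw [mul_comm]
      exact mul_le_mul ((hle B w).trans hB') h1 (hnn A w) (by linarith)
  have tot : ∑ w, 2 * ℓ * ∑ x, (if (x, w) ∈ s.discordant then (1 : ℝ) else 0) =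
      2 * ℓ * s.discordant.card := by
    rw [← Finset.mul_sum, Finset.sum_comm]
    congr 1
    rw [← Finset.sum_product' (f := fun x w => if (x, w) ∈ s.discordant then (1 : ℝ) else 0)]
    simp
  rw [tot] at up
  linarith

open Classical in
-- The hub drift `(1 - f v) * f u` vanishes when both endpoints are hubs, so such discordant edges
-- must be shown to be rare separately.
lemma davg_both_high_le (hN : 0 < N) (hℓ : 0 ≤ ℓ) (hs : (s.totalDeg : ℝ) = N * ℓ)
    (h : s.discordant.Nonempty) :
    davg s (fun e => if 3 / 4 * (N : ℝ) ≤ s.deg e.1 ∧ 3 / 4 * (N : ℝ) ≤ s.deg e.2 then 1 else 0) ≤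
      8 * ℓ / N := by
  have hN' : (0 : ℝ) < N := by exact_mod_cast hN
  have hD : (0 : ℝ) < s.discordant.card := by exact_mod_cast h.card_pos
  set A : Finset (Fin N) :=
    Finset.univ.filter fun v => s.opinion v = false ∧ 3 / 4 * (N : ℝ) ≤ s.deg v
  set B : Finset (Fin N) :=
    Finset.univ.filter fun v => s.opinion v = true ∧ 3 / 4 * (N : ℝ) ≤ s.deg v
  have hAB := card_mul_card_le hN hℓ hs A B (by simp [A]) (by simp [B])
  unfold davg
  rw [div_le_div_iff₀ hD hN', ← Finset.sum_filter, Finset.sum_const, nsmul_eq_mul, mul_one]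
  have hsub : s.discordant.filter (fun e => 3 / 4 * (N : ℝ) ≤ s.deg e.1 ∧
      3 / 4 * (N : ℝ) ≤ s.deg e.2) ⊆ A ×ˢ B ∪ B ×ˢ A := by
    rintro ⟨v, u⟩ he
    simp only [Finset.mem_filter, mem_discordant] at he
    simp only [Finset.mem_union, Finset.mem_product, A, B, Finset.mem_filter, Finset.mem_univ,
      true_and]
    obtain ⟨⟨_, h1⟩, h2, h3⟩ := he
    cases hv : s.opinion v <;> cases hu : s.opinion u <;> simp_all
  have hc : ((s.discordant.filter (fun e => 3 / 4 * (N : ℝ) ≤ s.deg e.1 ∧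
      3 / 4 * (N : ℝ) ≤ s.deg e.2)).card : ℝ) ≤ 2 * (A.card * B.card) := by
    have h1 := (Finset.card_le_card hsub).trans (Finset.card_union_le _ _)
    rw [Finset.card_product, Finset.card_product] at h1
    have : (((s.discordant.filter (fun e => 3 / 4 * (N : ℝ) ≤ s.deg e.1 ∧
      3 / 4 * (N : ℝ) ≤ s.deg e.2)).card : ℕ) : ℝ) ≤ ((A.card * B.card + B.card * A.card : ℕ) : ℝ) := by
      exact_mod_cast h1
    push_cast at this; linarith
  nlinarith [mul_le_mul_of_nonneg_right hc hN'.le]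

lemma card_targets_ge (hη : 2 ≤ η * N) {v : Fin N} (hv : ¬ (1 - η) * N ≤ s.deg v) :
    η * N / 2 ≤ (s.targets v).card := by
  have h : ((s.deg v + (s.targets v).card + 1 : ℕ) : ℝ) = N := by
    exact_mod_cast s.deg_add_card_targets v
  push_cast at h
  rw [not_le] at hv
  linarith

lemma full_eq_one_of_targets_empty (hη : 2 ≤ η * N) {v : Fin N} (h : ¬ (s.targets v).Nonempty) :
    s.full η v = 1 := by
  by_contra hc
  have hv : ¬ (1 - η) * N ≤ s.deg v := fun hv => hc (by simp [full, hv])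
  have := card_targets_ge hη hv
  rw [Finset.not_nonempty_iff_eq_empty.1 h] at this
  simp only [Finset.card_empty, Nat.cast_zero] at this
  linarith

open Classical in
/-- A set of at most `m` vertices is hit with probability at most `2 m / (η N)`, unless the
root has nearly full degree. -/
lemma tavg_indicator_le_full (hη : 2 ≤ η * N) (v : Fin N) (p : Fin N → Prop) {m : ℝ} (hm0 : 0 ≤ m)
    (hm : ((Finset.univ.filter p).card : ℝ) ≤ m) :
    tavg s v (fun z => if p z then 1 else 0) ≤ m / (η * N / 2) + s.full η v := by
  by_cases hv : (1 - η) * N ≤ s.deg v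
  · have h1 : tavg s v (fun z => if p z then (1 : ℝ) else 0) ≤ 1 :=
      tavg_le_of_le s v zero_le_one fun z _ => by split_ifs <;> norm_num
    have h2 : 0 ≤ m / (η * N / 2) := div_nonneg hm0 (by linarith)
    simp only [full, hv, if_true]; linarith
  · simp only [full, hv, if_false, add_zero]
    exact tavg_indicator_le s v p (by linarith) (card_targets_ge hη hv) hm

/-! ### Drift of the hub potential -/

section HubDrift

/-- The hub potential with thresholds `(1 - 2 η) N` and `(1 - η) N`. -/
noncomputable def hub (s : Config N) (η : ℝ) : ℝ := s.hubPotential ((1 - 2 * η) * N) (η * N)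

lemma hub_imitate (v u : Fin N) : (s.imitate v u).hub η = s.hub η := rfl

variable (hη0 : 0 < η) (hη8 : η ≤ 1 / 8) (hηN : 2 ≤ η * N) (hℓ : 1 ≤ ℓ)
  (hs : (s.totalDeg : ℝ) = N * ℓ)

include hη0 hη8 hηN hℓ hs

lemma hub_moveEdge {v u z : Fin N} (h : s.graph.Adj v u) (hz : z ∈ s.targets v) :
    |(s.moveEdge v u z).hub η - s.hub η -
      (-(1 - ramp ((1 - 2 * η) * N) (η * N) (s.deg v)) * ramp ((1 - 2 * η) * N) (η * N) (s.deg u) +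
        (1 - ramp ((1 - 2 * η) * N) (η * N) (s.deg v)) *
          ramp ((1 - 2 * η) * N) (η * N) (s.deg z))| ≤ 5 * ℓ / (η * N) := by
  have hN : 0 < N := v.pos
  have hN' : (0 : ℝ) < N := by exact_mod_cast hN
  have hb : 0 < η * N := by linarith
  have ha : (N : ℝ) / 2 ≤ (1 - 2 * η) * N := by nlinarith
  refine (hubPotential_moveEdge hb h hz (sum_ramp_le hb hN ha (by linarith) hs)
    (sum_ramp_le hb hN ha (by linarith) (by rw [totalDeg_moveEdge h hz, hs]))).trans ?_
  gcongr
  linarith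

/-- If `v` is not nearly full it has at least `η N / 2` targets, which share a total ramp weight of
at most `2 ℓ`, so the `f z` term is of order `ℓ / (η N)`. If `v` is nearly full, the factor `1 - f
v` removes that term. -/
lemma tavg_hub_le {v u : Fin N} (h : s.graph.Adj v u) :
    tavg s v (fun z => (s.moveEdge v u z).hub η - s.hub η) ≤
      -(1 - ramp ((1 - 2 * η) * N) (η * N) (s.deg v)) * ramp ((1 - 2 * η) * N) (η * N) (s.deg u) +
        9 * ℓ / (η * N) := by
  have hN : 0 < N := v.pos
  have hN' : (0 : ℝ) < N := by exact_mod_cast hN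
  have hb : 0 < η * N := by linarith
  have ha : (N : ℝ) / 2 ≤ (1 - 2 * η) * N := by nlinarith
  have hpos : 0 ≤ 9 * ℓ / (η * N) := by positivity
  set f : Fin N → ℝ := fun w => ramp ((1 - 2 * η) * N) (η * N) (s.deg w)
  change _ ≤ -(1 - f v) * f u + 9 * ℓ / (η * N)
  have hone : (1 - η) * N ≤ s.deg v → f v = 1 := fun hv => ramp_eq_one hb (by linarith)
  by_cases hT : (s.targets v).Nonempty
  · have h1 : tavg s v (fun z => (s.moveEdge v u z).hub η - s.hub η) ≤
        tavg s v (fun z => (-(1 - f v) * f u + 5 * ℓ / (η * N)) + (1 - f v) * f z) := by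
      refine tavg_mono s v fun z hz => ?_
      have := (abs_le.1 (hub_moveEdge hη0 hη8 hηN hℓ hs h hz)).2
      simp only [f]; linarith
    rw [tavg_add, tavg_const s hT, tavg_const_mul] at h1
    have h2 : (1 - f v) * tavg s v f ≤ 4 * ℓ / (η * N) := by
      by_cases hv : (1 - η) * N ≤ s.deg v
      · rw [hone hv]; simp; positivity
      · have h3 : tavg s v f ≤ 2 * ℓ / (η * N / 2) := by
          unfold tavg
          refine div_le_div₀ (by linarith) ?_ (by linarith) (card_targets_ge hηN hv)
          exact (Finset.sum_le_sum_of_subset_of_nonneg (Finset.subset_univ _) fun _ _ _ =>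
            ramp_nonneg _ _ _).trans (sum_ramp_le hb hN ha (by linarith) hs)
        have h4 : 0 ≤ tavg s v f := tavg_nonneg s v fun z _ => ramp_nonneg _ _ _
        have h5 : 0 ≤ f v := ramp_nonneg _ _ _
        have h6 : 2 * ℓ / (η * N / 2) = 4 * ℓ / (η * N) := by field_simp; ring
        nlinarith
    have h7 : 9 * ℓ / (η * N) = 5 * ℓ / (η * N) + 4 * ℓ / (η * N) := by ring
    linarith
  · rw [tavg_eq_zero s hT]
    have hf := full_eq_one_of_targets_empty hηN hT
    have hv : (1 - η) * N ≤ s.deg v := by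
      by_contra hc; simp [full, hc] at hf
    rw [hone hv]; simpa using hpos

/-- Votes leave the graph alone. After reversing orientation the drift is `-f v * (1 - f u)`, which
is `-1` at a nearly full root unless `u` has degree at least `3N/4` too (here `1 - 2η ≥ 3/4`
enters). The constant is `13 = 9 + 8 / 2`. -/
lemma integral_hub_le (hq0 : 0 ≤ q) (hq1 : q ≤ 1) (h : s.discordant.Nonempty) :
    ∫ t, (t.hub η - s.hub η) ∂(step q s).toMeasure ≤
      (1 - q) * (-(1 / 2) * davg s (fun e => s.full η e.1) + 13 * ℓ / (η * N)) := by
  classical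
  obtain ⟨e₀, _⟩ := id h
  have hN : 0 < N := e₀.1.pos
  have hN' : (0 : ℝ) < N := by exact_mod_cast hN
  have hb : 0 < η * N := by linarith
  set f : Fin N → ℝ := fun w => ramp ((1 - 2 * η) * N) (η * N) (s.deg w)
  rw [integral_step hq0 hq1 s _ (sub_self _)]
  simp only [hub_imitate, sub_self, mul_zero, zero_add, davg_const_mul]
  refine mul_le_mul_of_nonneg_left ?_ (by linarith)
  have h1 : davg s (fun e => tavg s e.1 fun z => (s.moveEdge e.1 e.2 z).hub η - s.hub η) ≤
      davg s (fun e => (-1) * ((1 - f e.1) * f e.2) + 9 * ℓ / (η * N)) := by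
    refine davg_mono s fun e he => ?_
    have := tavg_hub_le hη0 hη8 hηN hℓ hs (mem_discordant.1 he).1
    simp only [f]; linarith
  rw [davg_add, davg_const s h, davg_const_mul] at h1
  have h2 : davg s (fun e => s.full η e.1) ≤ davg s (fun e => 2 * ((1 - f e.2) * f e.1) +
      if 3 / 4 * (N : ℝ) ≤ s.deg e.1 ∧ 3 / 4 * (N : ℝ) ≤ s.deg e.2 then 1 else 0) := by
    refine davg_mono s fun e he => ?_
    have f1 : 0 ≤ f e.1 := ramp_nonneg _ _ _
    have f2 : f e.2 ≤ 1 := ramp_le_one _ _ _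
    have hnn := mul_nonneg (sub_nonneg.2 f2) f1
    unfold full
    split_ifs with c1 c2 c2
    · linarith
    · have f3 : f e.1 = 1 := ramp_eq_one hb (by linarith)
      have f4 : f e.2 ≤ 0 := by
        refine (ramp_eq_zero hb ?_).le
        by_contra hc
        refine c2 ⟨by nlinarith, by nlinarith⟩
      rw [f3]; linarith
    · linarith
    · linarith
  rw [davg_add, davg_const_mul,
    ← davg_swap s (fun e => (1 - f e.2) * f e.1)] at h2
  simp only [Prod.fst_swap, Prod.snd_swap] at h2
  have h3 := davg_both_high_le hN (by linarith) hs h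
  have h4 : 8 * ℓ / N ≤ 8 * ℓ / (η * N) := by gcongr; nlinarith
  have h5 : 13 * ℓ / (η * N) = 9 * ℓ / (η * N) + 8 * ℓ / (η * N) / 2 := by ring
  linarith

lemma hub_le : s.hub η ≤ 4 * η * (N * ℓ) := by
  classical
  rcases N.eq_zero_or_pos with hN | hN
  · subst hN; simp at hηN; linarith
  have hN' : (0 : ℝ) < N := by exact_mod_cast hN
  have ha : (N : ℝ) / 2 ≤ (1 - 2 * η) * N := by nlinarith
  have := hubPotential_le (s := s) (a := (1 - 2 * η) * N) (b := η * N) (m := 2 * ℓ)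
    (x := 2 * η * N) (by linarith) (by positivity)
    (card_deg_ge_le (by linarith) hs (by nlinarith)) (by linarith)
  unfold hub; linarith

lemma neg_le_hub : -(2 * ℓ ^ 2) ≤ s.hub η := by
  rcases N.eq_zero_or_pos with hN | hN
  · subst hN; simp at hηN; linarith
  have hN' : (0 : ℝ) < N := by exact_mod_cast hN
  have ha : (N : ℝ) / 2 ≤ (1 - 2 * η) * N := by nlinarith
  have := neg_sq_le_hubPotential (s := s) (sum_ramp_le (b := η * N) (by linarith) hN ha (by linarith) hs)
  unfold hub; linarith

end HubDrift

/-! ### Drifts of the edge potential and of the weighted count of ones -/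

section EdgeDrift

/-- The errors are: the discretisation `1 / x`; hitting one of the `ρ N` ones among at least `η N /
2` targets; hitting one of the at most `2 N / K` vertices of degree at least `x / 2`, with weight
`5`. At a nearly full root both hitting probabilities are bounded by `1`, whence `6 = 1 + 5`. -/
lemma integral_edgePotential_le (hη0 : 0 < η) (hηN : 2 ≤ η * N) (hℓ : 1 ≤ ℓ) (hK : 2 ≤ K)
    (hρ : 0 ≤ ρ) (hs : (s.totalDeg : ℝ) = N * ℓ) (hones : (s.ones : ℝ) ≤ ρ * N)
    (hq0 : 0 ≤ q) (hq1 : q ≤ 1) (h : s.discordant.Nonempty) :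
    ∫ t, (t.edgePotential (K * ℓ) - s.edgePotential (K * ℓ)) ∂(step q s).toMeasure ≤
      q * davg s (fun e => if s.opinion e.1 = true then 0 else
        if (s.deg e.1 : ℝ) < 2 * (K * ℓ) then 2 * (K * ℓ) else 0) +
      (1 - q) * (-(1 / 2) + (1 / (K * ℓ) + 2 * ρ / η + 20 / (K * η)) +
        6 * davg s (fun e => s.full η e.1)) := by
  classical
  obtain ⟨e₀, _⟩ := id h
  have hN : 0 < N := e₀.1.pos
  have hN' : (0 : ℝ) < N := by exact_mod_cast hN
  have hb : 0 < η * N := by linarith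
  have hx2 : 2 ≤ K * ℓ := by nlinarith
  set x := K * ℓ
  have hx0 : 0 < x := by linarith
  set err := 1 / x + 2 * ρ / η + 20 / (K * η)
  have herr : 0 ≤ err := by positivity
  have hmove : ∀ e ∈ s.discordant, tavg s e.1 (fun z =>
      (s.moveEdge e.1 e.2 z).edgePotential x - s.edgePotential x) ≤
      (-1) * (ramp x x (s.deg e.2) + s.lowZero x e.1) + (err + 6 * s.full η e.1) := by
    intro e he
    obtain ⟨hadj, hop⟩ := mem_discordant.1 he
    have k1 := ramp_le_one x x (s.deg e.2)
    have k2 := lowZero_le_one (s := s) x e.1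
    by_cases hT : (s.targets e.1).Nonempty
    · have h1 : tavg s e.1 (fun z => (s.moveEdge e.1 e.2 z).edgePotential x - s.edgePotential x) ≤
          tavg s e.1 (fun z => ((-ramp x x (s.deg e.2) - s.lowZero x e.1 + 1 / x) +
            (if s.opinion z = true then 1 else 0)) +
            5 * (if x / 2 ≤ (s.deg z : ℝ) then 1 else 0)) := by
        refine tavg_mono s e.1 fun z hz => ?_
        have := (edgePotential_moveEdge hx2 hadj hop hz).1
        linarith
      rw [tavg_add, tavg_add, tavg_const s hT, tavg_const_mul] at h1
      have h2 := tavg_indicator_le_full (s := s) hηN e.1 (fun z => s.opinion z = true)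
        (m := ρ * N) (by positivity) (le_trans (le_of_eq (by unfold ones; congr!)) hones)
      have h3 := tavg_indicator_le_full (s := s) hηN e.1 (fun z => x / 2 ≤ (s.deg z : ℝ))
        (m := 2 * N / K) (by positivity)
        (card_deg_ge_le (by linarith) hs (le_of_eq (by simp only [x]; field_simp)))
      have h4 : ρ * N / (η * N / 2) = 2 * ρ / η := by field_simp
      have h5 : 2 * N / K / (η * N / 2) = 4 / (K * η) := by field_simp; ring
      have h6 : 20 / (K * η) = 5 * (4 / (K * η)) := by ring
      rw [h4] at h2
      rw [h5] at h3
      have h2' : tavg s e.1 (fun z => if s.opinion z = true then (1 : ℝ) else 0) ≤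
        2 * ρ / η + s.full η e.1 := by convert h2
      simp only [err]
      linarith
    · rw [tavg_eq_zero s hT, full_eq_one_of_targets_empty hηN hT]
      linarith
  rw [integral_step hq0 hq1 s _ (sub_self _)]
  have h1 := davg_mono s (F := fun e =>
      q * ((s.imitate e.1 e.2).edgePotential x - s.edgePotential x) +
        (1 - q) * tavg s e.1 fun z => (s.moveEdge e.1 e.2 z).edgePotential x - s.edgePotential x)
    (G := fun e => q * (if s.opinion e.1 = true then 0 else
        if (s.deg e.1 : ℝ) < 2 * x then 2 * x else 0) + (1 - q) *
        ((-1) * (ramp x x (s.deg e.2) + s.lowZero x e.1) + (err + 6 * s.full η e.1)))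
    fun e he => add_le_add
      (mul_le_mul_of_nonneg_left (edgePotential_imitate_le hx0 (mem_discordant.1 he).2) hq0)
      (mul_le_mul_of_nonneg_left (hmove e he) (by linarith))
  refine h1.trans ?_
  rw [davg_add, davg_const_mul, davg_const_mul, davg_add, davg_const_mul,
    davg_add s (fun _ => err), davg_const s h, davg_const_mul]
  -- At the zero endpoint of the edge `ramp + lowZero = 1`, and each endpoint is met in both roles
  -- over the two orientations.
  have h2 : 1 / 2 ≤ davg s (fun e => ramp x x (s.deg e.2) + s.lowZero x e.1) := by
    have e1 := davg_swap s (fun e => ramp x x (s.deg e.2) + s.lowZero x e.1)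
    simp only [Prod.fst_swap, Prod.snd_swap] at e1
    have e2 := davg_mono s (F := fun _ => (1 : ℝ))
      (G := fun e => (ramp x x (s.deg e.1) + s.lowZero x e.2) +
        (ramp x x (s.deg e.2) + s.lowZero x e.1)) fun e he => ?_
    · rw [davg_const s h, davg_add, e1] at e2
      linarith
    · have ho := (mem_discordant.1 he).2
      have a1 := ramp_nonneg x x (s.deg e.1)
      have a2 := ramp_nonneg x x (s.deg e.2)
      unfold lowZero
      cases hv : s.opinion e.1 <;> cases hu : s.opinion e.2 <;> simp_all <;> linarith
  have := mul_le_mul_of_nonneg_left h2 (show 0 ≤ 1 - q by linarith)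
  nlinarith

end EdgeDrift

/-- A vote at a one `v` loses `q * (1 - q) ^ deg v`; a rewiring away from a one `u` gains `(1 - q) *
q * (1 - q) ^ (deg u - 1)`, the same expression at `u`. After reversal these cancel exactly, which
dictates the base `1 - q`. -/
lemma le_integral_onesPotential (hη0 : 0 < η) (hηN : 2 ≤ η * N)
    (hρ : 0 ≤ ρ) (hones : (s.ones : ℝ) ≤ ρ * N)
    (hq0 : 0 ≤ q) (hq1 : q ≤ 1) (h : s.discordant.Nonempty) :
    q * (davg s (fun e => if s.opinion e.1 = true then 0 else (1 - q) ^ s.deg e.1) -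
      2 * davg s (fun e => s.full η e.1) - 2 * ρ / η) ≤
    ∫ t, (t.onesPotential (1 - q) - s.onesPotential (1 - q)) ∂(step q s).toMeasure := by
  classical
  obtain ⟨e₀, _⟩ := id h
  have hN : 0 < N := e₀.1.pos
  have hN' : (0 : ℝ) < N := by exact_mod_cast hN
  have hr0 : 0 ≤ 1 - q := by linarith
  have hr1 : 1 - q ≤ 1 := by linarith
  set W : Fin N → ℝ := fun v => if s.opinion v = true then (1 - q) ^ s.deg v else 0
  have hW1 : ∀ v, W v ≤ 1 := fun v => by
    simp only [W]; split_ifs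
    · exact pow_le_one₀ hr0 hr1
    · exact zero_le_one
  have hmove : ∀ e ∈ s.discordant, q * (W e.2 - 2 * s.full η e.1 - 2 * ρ / η) ≤
      (1 - q) * tavg s e.1 (fun z =>
        (s.moveEdge e.1 e.2 z).onesPotential (1 - q) - s.onesPotential (1 - q)) := by
    intro e he
    have hadj := (mem_discordant.1 he).1
    have hρη : 0 ≤ 2 * ρ / η := by positivity
    have hf0 := full_nonneg (s := s) η e.1
    by_cases hT : (s.targets e.1).Nonempty
    · have h1 : tavg s e.1 (fun z => q * (if s.opinion e.2 = true then
          (1 - q) ^ (s.deg e.2 - 1) else 0) + (-q) * (if s.opinion z = true then 1 else 0)) ≤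
          tavg s e.1 (fun z =>
            (s.moveEdge e.1 e.2 z).onesPotential (1 - q) - s.onesPotential (1 - q)) := by
        refine tavg_mono s e.1 fun z hz => ?_
        have := (onesPotential_moveEdge hr0 hr1 hadj hz).1
        rw [sub_sub_cancel] at this
        linarith
      rw [tavg_add, tavg_const s hT, tavg_const_mul] at h1
      have h2 := tavg_indicator_le_full (s := s) hηN e.1 (fun z => s.opinion z = true)
        (m := ρ * N) (by positivity) (le_trans (le_of_eq (by unfold ones; congr!)) hones)
      have h4 : ρ * N / (η * N / 2) = 2 * ρ / η := by field_simp
      rw [h4] at h2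
      have h2' : tavg s e.1 (fun z => if s.opinion z = true then (1 : ℝ) else 0) ≤
        2 * ρ / η + s.full η e.1 := by convert h2
      have h5 : (1 - q) * (if s.opinion e.2 = true then (1 - q) ^ (s.deg e.2 - 1) else 0) =
          W e.2 := by
        simp only [W]
        split_ifs
        · rw [← pow_succ', Nat.sub_add_cancel (deg_pos_of_adj hadj)]
        · simp
      have h6 : 0 ≤ tavg s e.1 (fun z => if s.opinion z = true then (1 : ℝ) else 0) :=
        tavg_nonneg s e.1 fun z _ => by split_ifs <;> norm_num
      refine le_trans ?_ (mul_le_mul_of_nonneg_left h1 hr0)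
      have h7 : (1 - q) * (q * (if s.opinion e.2 = true then (1 - q) ^ (s.deg e.2 - 1) else 0) +
          -q * tavg s e.1 (fun z => if s.opinion z = true then (1 : ℝ) else 0)) =
          q * (W e.2 - (1 - q) * tavg s e.1 (fun z => if s.opinion z = true then (1 : ℝ) else 0)) := by
        rw [← h5]; ring
      rw [h7]
      refine mul_le_mul_of_nonneg_left ?_ hq0
      nlinarith
    · rw [tavg_eq_zero s hT, full_eq_one_of_targets_empty hηN hT, mul_zero]
      have := hW1 e.2
      nlinarith
  rw [integral_step hq0 hq1 s _ (sub_self _)]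
  have h1 := davg_mono s (F := fun e => q * ((if s.opinion e.1 = true then 0 else
        (1 - q) ^ s.deg e.1) + (-1) * W e.1) + q * ((W e.2 + (-2) * s.full η e.1) + -(2 * ρ / η)))
    (G := fun e => q * ((s.imitate e.1 e.2).onesPotential (1 - q) - s.onesPotential (1 - q)) +
      (1 - q) * tavg s e.1 fun z =>
        (s.moveEdge e.1 e.2 z).onesPotential (1 - q) - s.onesPotential (1 - q))
    fun e he => add_le_add (mul_le_mul_of_nonneg_left ?_ hq0)
      (le_trans (le_of_eq (by ring)) (hmove e he))
  · refine le_trans (le_of_eq ?_) h1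
    have e1 := davg_swap s (fun e => W e.1)
    simp only [Prod.fst_swap] at e1
    rw [davg_add, davg_const_mul, davg_const_mul, davg_add, davg_add, davg_add, davg_const s h,
      davg_const_mul, davg_const_mul, e1]
    ring
  · rw [onesPotential_imitate (mem_discordant.1 he).2]
    simp only [W]
    split_ifs <;> simp

end Config

/-! ### The combined potential: drift, oscillation and second moment -/

/-- The constants entering the potential, for vertices of degree at most `K ℓ`: `E` compensates
the decay of the weights `(1 - q) ^ degree`, `β` and `η` control the updates with a root of nearly
full degree and `ρ` bounds the fraction of vertices in state `1`. -/
structure Tuned (ν K E β η ρ : ℝ) : Prop where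
  hν : 0 < ν
  hK : K = 192000
  hE : E = Real.exp (4 * K * ν)
  hβ : β = 16 * K * ν * E
  hη0 : 0 < η
  hη8 : η ≤ 1 / 8
  hβη : 4 * β * η ≤ 1 / 10
  hρ0 : 0 < ρ
  hρ1 : 960 * ρ ≤ 1 / 50
  hρ2 : β * ρ / (4 * η) ≤ 1 / 50
  hρ3 : 2 * K * E * ρ ≤ 1 / 10

/-- The number of vertices is large enough, and the mean degree `ℓ` is large but much smaller. -/
structure Large (N : ℕ) (ν β η ℓ : ℝ) : Prop where
  hℓ : 1 ≤ ℓ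
  hq : ν / ℓ ≤ 1 / 20
  hN1 : 2 ≤ 1 / 480 * (N : ℝ)
  hN2 : 2 ≤ η * (N : ℝ)
  hs1 : 12 * (13 * ℓ / (1 / 480 * (N : ℝ))) + β * (13 * ℓ / (η * N)) ≤ 1 / 100
  hs2 : (12 + β) * (2 * ℓ) ≤ 1 / 100 * N
  hs3 : 5 * ℓ / (1 / 480 * (N : ℝ)) ≤ 1
  hs4 : 5 * ℓ / (η * N) ≤ 1

lemma exp_neg_two_mul_le {q : ℝ} (h0 : 0 ≤ q) (h1 : q ≤ 1 / 2) : Real.exp (-(2 * q)) ≤ 1 - q := by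
  rw [Real.exp_neg, inv_le_comm₀ (Real.exp_pos _) (by linarith)]
  refine le_trans ?_ (Real.add_one_le_exp (2 * q))
  rw [inv_le_iff_one_le_mul₀ (by linarith)]
  nlinarith

lemma Tuned.E_pos {ν K E β η ρ : ℝ} (hT : Tuned ν K E β η ρ) : 0 < E := by rw [hT.hE]; exact Real.exp_pos _

lemma Tuned.β_pos {ν K E β η ρ : ℝ} (hT : Tuned ν K E β η ρ) : 0 < β := by
  have := hT.E_pos
  have := hT.hν
  have := hT.hK
  rw [hT.hβ, hT.hK]; positivity

namespace Config

variable {N : ℕ} {s : Config N} {ν K E β η ρ ℓ : ℝ}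

/-- A potential which decreases on average as long as there are discordant edges and few vertices
in state `1`. -/
noncomputable def potential (s : Config N) (ν K E β η ℓ : ℝ) : ℝ :=
  s.edgePotential (K * ℓ) + -(2 * (K * ℓ) * E) * s.onesPotential (1 - ν / ℓ) +
    12 * s.hub (1 / 480) + β * s.hub η

/-- Budget: `-1/2` plus errors `1/100 + 1/50 + 1/20 + 1/100` is `-41/100`; multiplying by `1 - q ≥
19/20` and adding `1/50` from the ones term leaves less than `-9/25`. The multiplier `12` cancels `6
* P1` exactly, and the `β` hub term outweighs the `β / 4 * P2` from the ones. -/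
lemma integral_potential_le (hT : Tuned ν K E β η ρ) (hL : Large N ν β η ℓ)
    (hs : (s.totalDeg : ℝ) = N * ℓ) (hones : (s.ones : ℝ) ≤ ρ * N) (h : s.discordant.Nonempty) :
    ∫ t, (t.potential ν K E β η ℓ - s.potential ν K E β η ℓ) ∂(step (ν / ℓ) s).toMeasure ≤
      -(9 / 25) := by
  obtain ⟨hℓ, hq, hN1, hN2, hs1, hs2, hs3, hs4⟩ := hL
  have hE0 := hT.E_pos
  have hβ0 := hT.β_pos
  obtain ⟨hν, hK, hE, hβ, hη0, hη8, hβη, hρ0, hρ1, hρ2, hρ3⟩ := hT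
  have hK0 : 0 < K := by rw [hK]; norm_num
  have hℓ0 : 0 < ℓ := by linarith
  set q := ν / ℓ
  have hq0 : 0 ≤ q := by positivity
  have hq1 : q ≤ 1 := by linarith
  have hqℓ : q * ℓ = ν := by simp only [q]; field_simp
  have hi : ∀ f : Config N → ℝ, Integrable f (step q s).toMeasure := fun f => .of_finite
  have e0 : ∫ t, (t.potential ν K E β η ℓ - s.potential ν K E β η ℓ) ∂(step q s).toMeasure =
      ∫ t, (t.edgePotential (K * ℓ) - s.edgePotential (K * ℓ)) ∂(step q s).toMeasure +
      -(2 * (K * ℓ) * E) *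
        ∫ t, (t.onesPotential (1 - q) - s.onesPotential (1 - q)) ∂(step q s).toMeasure +
      12 * ∫ t, (t.hub (1 / 480) - s.hub (1 / 480)) ∂(step q s).toMeasure +
      β * ∫ t, (t.hub η - s.hub η) ∂(step q s).toMeasure := by
    rw [← integral_const_mul, ← integral_const_mul, ← integral_const_mul,
      ← integral_add (hi _) (hi _), ← integral_add (hi _) (hi _), ← integral_add (hi _) (hi _)]
    congr 1
    ext t
    simp only [potential, q]; ring
  have i1 := integral_edgePotential_le (η := 1 / 480) (K := K) (by norm_num) hN1 hℓ
    (by rw [hK]; norm_num) hρ0.le hs hones hq0 hq1 h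
  have i2 := le_integral_onesPotential hη0 hN2 hρ0.le hones hq0 hq1 h
  have i3 := integral_hub_le (η := 1 / 480) (by norm_num) (by norm_num) hN1 hℓ hs hq0 hq1 h
  have i4 := integral_hub_le hη0 hη8 hN2 hℓ hs hq0 hq1 h
  -- For degrees below `2 K ℓ` one has `(1 - q) ^ degree ≥ exp (-4 K ν) = 1 / E`, so the gain from
  -- new ones covers the edges destroyed by votes.
  have flip : davg s (fun e => if s.opinion e.1 = true then 0 else
        if (s.deg e.1 : ℝ) < 2 * (K * ℓ) then 2 * (K * ℓ) else 0) ≤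
      (2 * (K * ℓ) * E) *
        davg s (fun e => if s.opinion e.1 = true then 0 else (1 - q) ^ s.deg e.1) := by
    rw [← davg_const_mul]
    refine davg_mono s fun e _ => ?_
    have hp : 0 ≤ (1 - q) ^ s.deg e.1 := pow_nonneg (by linarith) _
    split_ifs with h1 h2
    · simp
    · have h3 : Real.exp (-(4 * K * ν)) ≤ (1 - q) ^ s.deg e.1 := by
        calc Real.exp (-(4 * K * ν)) ≤ Real.exp (s.deg e.1 * -(2 * q)) := by
              refine Real.exp_le_exp.2 ?_
              have : q * s.deg e.1 ≤ q * (2 * (K * ℓ)) := mul_le_mul_of_nonneg_left h2.le hq0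
              have h5 : q * (2 * (K * ℓ)) = 2 * K * ν := by rw [← hqℓ]; ring
              linarith
          _ = Real.exp (-(2 * q)) ^ s.deg e.1 := by rw [Real.exp_nat_mul]
          _ ≤ _ := pow_le_pow_left₀ (Real.exp_pos _).le
              (exp_neg_two_mul_le hq0 (by linarith)) _
      have h4 : 1 ≤ E * (1 - q) ^ s.deg e.1 := by
        calc 1 = E * Real.exp (-(4 * K * ν)) := by rw [hE, ← Real.exp_add]; simp
          _ ≤ _ := mul_le_mul_of_nonneg_left h3 hE0.le
      calc 2 * (K * ℓ) = 2 * (K * ℓ) * 1 := by ring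
        _ ≤ 2 * (K * ℓ) * (E * (1 - q) ^ s.deg e.1) :=
          mul_le_mul_of_nonneg_left h4 (by positivity)
        _ = _ := by ring
    · positivity
  set W := davg s (fun e => if s.opinion e.1 = true then 0 else (1 - q) ^ s.deg e.1)
  set P1 := davg s (fun e => s.full (1 / 480) e.1)
  set P2 := davg s (fun e => s.full η e.1)
  have hP1 : 0 ≤ P1 := davg_nonneg s fun e _ => full_nonneg _ _
  have hP2 : 0 ≤ P2 := davg_nonneg s fun e _ => full_nonneg _ _
  have c1 : 1 / (K * ℓ) ≤ 1 / 100 := by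
    rw [hK]
    rw [div_le_div_iff₀ (by positivity) (by norm_num)]
    linarith
  have c2 : 2 * ρ / (1 / 480) ≤ 1 / 50 := by linarith
  have c3 : 20 / (K * (1 / 480)) = 1 / 20 := by rw [hK]; norm_num
  have j2 := mul_le_mul_of_nonneg_left i2 (show 0 ≤ 2 * (K * ℓ) * E by positivity)
  have j2' : 2 * (K * ℓ) * E * (q * (W - 2 * P2 - 2 * ρ / η)) =
      q * (2 * (K * ℓ) * E * W) - β / 4 * P2 - β * ρ / (4 * η) := by
    have h1 : q * (2 * (K * ℓ) * E) = β / 8 := by rw [hβ, ← hqℓ]; ring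
    calc 2 * (K * ℓ) * E * (q * (W - 2 * P2 - 2 * ρ / η)) =
        q * (2 * (K * ℓ) * E * W) - q * (2 * (K * ℓ) * E) * (2 * P2 + 2 * ρ / η) := by ring
      _ = _ := by rw [h1]; field_simp; ring
  have j1 := mul_le_mul_of_nonneg_left flip hq0
  have j4 := mul_le_mul_of_nonneg_left i4 hβ0.le
  have k1 : (1 - q) * (-(1 / 2) + (1 / (K * ℓ) + 2 * ρ / (1 / 480) + 20 / (K * (1 / 480))) + 6 * P1)
      + 12 * ((1 - q) * (-(1 / 2) * P1 + 13 * ℓ / (1 / 480 * N))) +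
      β * ((1 - q) * (-(1 / 2) * P2 + 13 * ℓ / (η * N))) ≤
      (1 - q) * (-(41 / 100) - β / 2 * P2) := by
    have : (1 - q) * (-(1 / 2) + (1 / (K * ℓ) + 2 * ρ / (1 / 480) + 20 / (K * (1 / 480))) + 6 * P1)
      + 12 * ((1 - q) * (-(1 / 2) * P1 + 13 * ℓ / (1 / 480 * N))) +
      β * ((1 - q) * (-(1 / 2) * P2 + 13 * ℓ / (η * N))) =
      (1 - q) * (-(1 / 2) + (1 / (K * ℓ) + 2 * ρ / (1 / 480) + 20 / (K * (1 / 480))) +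
        (12 * (13 * ℓ / (1 / 480 * (N : ℝ))) + β * (13 * ℓ / (η * N))) - β / 2 * P2) := by ring
    rw [this]
    refine mul_le_mul_of_nonneg_left ?_ (by linarith)
    rw [c3]
    linarith
  have k2 : (1 - q) * (-(41 / 100) - β / 2 * P2) ≤ 19 / 20 * (-(41 / 100) - β / 2 * P2) := by
    have : 0 ≤ β / 2 * P2 := by positivity
    nlinarith
  have k3 : 0 ≤ β * P2 := by positivity
  rw [e0]
  rw [j2'] at j2
  linarith

/-- `1.81 = 3/2 + 3 * (1/10) + 1/100`: the edge potential lies in `[-Nℓ/2, Nℓ]`, the ones and the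
two hub terms account for a tenth each, and the lower hub bounds of order `ℓ ^ 2` are negligible
against `N ℓ`. -/
lemma potential_sub_le (hT : Tuned ν K E β η ρ) (hL : Large N ν β η ℓ) {s₀ : Config N}
    (hs₀ : (s₀.totalDeg : ℝ) = N * ℓ) (hs : (s.totalDeg : ℝ) = N * ℓ)
    (hones : (s.ones : ℝ) ≤ ρ * N) :
    s₀.potential ν K E β η ℓ - s.potential ν K E β η ℓ ≤ 181 / 100 * (N * ℓ) := by
  obtain ⟨hℓ, hq, hN1, hN2, hs1, hs2, hs3, hs4⟩ := hL
  have hE0 := hT.E_pos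
  have hβ0 := hT.β_pos
  obtain ⟨hν, hK, hE, hβ, hη0, hη8, hβη, hρ0, hρ1, hρ2, hρ3⟩ := hT
  have hK0 : 0 < K := by rw [hK]; norm_num
  have hℓ0 : 0 < ℓ := by linarith
  have hq0 : 0 ≤ ν / ℓ := by positivity
  have hNℓ : 0 ≤ (N : ℝ) * ℓ := by positivity
  have a1 := edgePotential_le (s := s₀) (K * ℓ)
  have a2 := le_edgePotential (s := s) (K * ℓ)
  have b1 := onesPotential_nonneg (s := s₀) (r := 1 - ν / ℓ) (by linarith)
  have b2 := (onesPotential_le (s := s) (r := 1 - ν / ℓ) (by linarith) (by linarith)).trans hones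
  have c1 := hub_le (s := s₀) (η := 1 / 480) (by norm_num) (by norm_num) hN1 hℓ hs₀
  have c2 := neg_le_hub (s := s) (η := 1 / 480) (by norm_num) (by norm_num) hN1 hℓ hs
  have d1 := hub_le hη0 hη8 hN2 hℓ hs₀
  have d2 := neg_le_hub hη0 hη8 hN2 hℓ hs
  have hlam : 0 ≤ 2 * (K * ℓ) * E := by positivity
  have f1 := mul_nonneg hlam b1
  have f2 := mul_le_mul_of_nonneg_left b2 hlam
  have f3 : 2 * (K * ℓ) * E * (ρ * N) = 2 * K * E * ρ * (N * ℓ) := by ring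
  have f4 := mul_le_mul_of_nonneg_right hρ3 hNℓ
  have g1 := mul_le_mul_of_nonneg_left d1 hβ0.le
  have g2 := mul_le_mul_of_nonneg_left d2 hβ0.le
  have g3 : β * (4 * η * (N * ℓ)) = 4 * β * η * (N * ℓ) := by ring
  have g4 := mul_le_mul_of_nonneg_right hβη hNℓ
  have h1 := mul_le_mul_of_nonneg_right hs2 hℓ0.le
  have h2 : (12 + β) * (2 * ℓ) * ℓ = 12 * (2 * ℓ ^ 2) + β * (2 * ℓ ^ 2) := by ring
  unfold potential
  rw [hs₀] at a1
  rw [hs] at a2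
  linarith

lemma abs_potential_imitate_le (hT : Tuned ν K E β η ρ) (hL : Large N ν β η ℓ) {v u : Fin N}
    (h : s.opinion v ≠ s.opinion u) :
    |(s.imitate v u).potential ν K E β η ℓ - s.potential ν K E β η ℓ| ≤ (2 * K + 2 * K * E) * ℓ := by
  obtain ⟨hℓ, hq, -⟩ := hL
  have hE0 := hT.E_pos
  obtain ⟨hν, hK, -⟩ := hT
  have hK0 : 0 < K := by rw [hK]; norm_num
  have hℓ0 : 0 < ℓ := by linarith
  have hq0 : 0 ≤ ν / ℓ := by positivity
  have a1 := abs_edgePotential_imitate_le (s := s) (x := K * ℓ) (by positivity) h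
  have a2 : |(s.imitate v u).onesPotential (1 - ν / ℓ) - s.onesPotential (1 - ν / ℓ)| ≤ 1 := by
    rw [onesPotential_imitate h]
    have p0 : 0 ≤ (1 - ν / ℓ) ^ s.deg v := pow_nonneg (by linarith) _
    have p1 : (1 - ν / ℓ) ^ s.deg v ≤ 1 := pow_le_one₀ (by linarith) (by linarith)
    split_ifs
    · rwa [abs_neg, abs_of_nonneg p0]
    · rwa [abs_of_nonneg p0]
  have e : (s.imitate v u).potential ν K E β η ℓ - s.potential ν K E β η ℓ =
      ((s.imitate v u).edgePotential (K * ℓ) - s.edgePotential (K * ℓ)) + -(2 * (K * ℓ) * E) *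
        ((s.imitate v u).onesPotential (1 - ν / ℓ) - s.onesPotential (1 - ν / ℓ)) := by
    simp only [potential, hub_imitate]; ring
  rw [e]
  refine (abs_add_le _ _).trans ?_
  have hlam : 0 ≤ 2 * (K * ℓ) * E := by positivity
  rw [abs_mul, abs_neg, abs_of_nonneg hlam]
  have := mul_le_mul_of_nonneg_left a2 hlam
  linarith

/-- The multiplier of the ones term is of order `ℓ`, but a rewiring changes that count by at most `ν
/ ℓ`. The bound sums `9 + 12 * 2` and `β / 8 + 2 * β ≤ 3 * β`. -/
lemma abs_potential_moveEdge_le (hT : Tuned ν K E β η ρ) (hL : Large N ν β η ℓ) {v u z : Fin N}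
    (hs : (s.totalDeg : ℝ) = N * ℓ) (hadj : s.graph.Adj v u) (h : s.opinion v ≠ s.opinion u)
    (hz : z ∈ s.targets v) :
    |(s.moveEdge v u z).potential ν K E β η ℓ - s.potential ν K E β η ℓ| ≤ 33 + 3 * β := by
  obtain ⟨hℓ, hq, hN1, hN2, hs1, hs2, hs3, hs4⟩ := hL
  have hE0 := hT.E_pos
  have hβ0 := hT.β_pos
  obtain ⟨hν, hK, hE, hβ, hη0, hη8, hβη, hρ0, hρ1, hρ2, hρ3⟩ := hT
  have hK0 : 0 < K := by rw [hK]; norm_num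
  have hℓ0 : 0 < ℓ := by linarith
  have hq0 : 0 ≤ ν / ℓ := by positivity
  have hqℓ : ν / ℓ * ℓ = ν := by field_simp
  have a1 := (edgePotential_moveEdge (s := s) (x := K * ℓ) (by rw [hK]; linarith) hadj h hz).2
  have a2 := (onesPotential_moveEdge (s := s) (r := 1 - ν / ℓ) (by linarith) (by linarith)
    hadj hz).2
  have aux : ∀ η' : ℝ, 0 < η' → η' ≤ 1 / 8 → 2 ≤ η' * (N : ℝ) → 5 * ℓ / (η' * N) ≤ 1 →
      |(s.moveEdge v u z).hub η' - s.hub η'| ≤ 2 := by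
    intro η' h1 h2 h3 h4
    have := hub_moveEdge h1 h2 h3 hℓ hs hadj hz
    set hv := ramp ((1 - 2 * η') * N) (η' * N) (s.deg v)
    set hu := ramp ((1 - 2 * η') * N) (η' * N) (s.deg u)
    set hzz := ramp ((1 - 2 * η') * N) (η' * N) (s.deg z)
    have v0 : 0 ≤ hv := ramp_nonneg _ _ _
    have v1 : hv ≤ 1 := ramp_le_one _ _ _
    have u0 : 0 ≤ hu := ramp_nonneg _ _ _
    have u1 : hu ≤ 1 := ramp_le_one _ _ _
    have z0 : 0 ≤ hzz := ramp_nonneg _ _ _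
    have z1 : hzz ≤ 1 := ramp_le_one _ _ _
    have w0 : 0 ≤ 1 - hv := by linarith
    have w1 : 1 - hv ≤ 1 := by linarith
    have m1 := mul_nonneg w0 u0
    have m2 := mul_nonneg w0 z0
    have m3 := mul_le_one₀ w1 u0 u1
    have m4 := mul_le_one₀ w1 z0 z1
    rw [abs_le] at this ⊢
    constructor <;> linarith
  have a3 := aux (1 / 480) (by norm_num) (by norm_num) hN1 hs3
  have a4 := aux η hη0 hη8 hN2 hs4
  have e : (s.moveEdge v u z).potential ν K E β η ℓ - s.potential ν K E β η ℓ =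
      ((s.moveEdge v u z).edgePotential (K * ℓ) - s.edgePotential (K * ℓ)) + -(2 * (K * ℓ) * E) *
        ((s.moveEdge v u z).onesPotential (1 - ν / ℓ) - s.onesPotential (1 - ν / ℓ)) +
      12 * ((s.moveEdge v u z).hub (1 / 480) - s.hub (1 / 480)) +
      β * ((s.moveEdge v u z).hub η - s.hub η) := by
    simp only [potential]; ring
  have hlam : 0 ≤ 2 * (K * ℓ) * E := by positivity
  have b2 := mul_le_mul_of_nonneg_left a2 hlam
  have b3 : 2 * (K * ℓ) * E * (1 - (1 - ν / ℓ)) = β / 8 := by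
    have h1 : 2 * (K * ℓ) * E * (1 - (1 - ν / ℓ)) = 2 * K * E * (ν / ℓ * ℓ) := by ring
    rw [h1, hqℓ, hβ]; ring
  have b4 := mul_le_mul_of_nonneg_left a4 hβ0.le
  rw [e]
  refine (abs_add_le _ _).trans ((add_le_add_left (abs_add_three _ _ _) _).trans ?_)
  rw [abs_mul, abs_mul, abs_mul, abs_neg, abs_of_nonneg hlam, abs_of_nonneg hβ0.le,
    abs_of_nonneg (show (0 : ℝ) ≤ 12 by norm_num)]
  linarith

/-- A bound for the second moment of the increments of the potential, per unit of mean degree. -/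
noncomputable def varianceBound (ν K E β : ℝ) : ℝ :=
  2 * (ν * (2 * K + 2 * K * E) ^ 2 + (33 + 3 * β) ^ 2) + 1

/-- Votes move the potential by order `ℓ` with probability `ν / ℓ`, rewirings by order one. Over a
time of order `N ℓ` the total, of order `N ℓ ^ 2`, is small against `(N ℓ) ^ 2`. -/
lemma integral_potential_sq_le (hT : Tuned ν K E β η ρ) (hL : Large N ν β η ℓ)
    (hs : (s.totalDeg : ℝ) = N * ℓ) (h : s.discordant.Nonempty) :
    ∫ t, (t.potential ν K E β η ℓ - s.potential ν K E β η ℓ + 9 / 25) ^ 2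
      ∂(step (ν / ℓ) s).toMeasure ≤ varianceBound ν K E β * ℓ := by
  have hℓ := hL.hℓ
  have hq := hL.hq
  have hν := hT.hν
  have hβ0 := hT.β_pos
  have hℓ0 : 0 < ℓ := by linarith
  set q := ν / ℓ
  have hq0 : 0 ≤ q := by positivity
  have hq1 : q ≤ 1 := by linarith
  have hqℓ : q * ℓ = ν := by simp only [q]; field_simp
  have h1 : ∫ t, (t.potential ν K E β η ℓ - s.potential ν K E β η ℓ) ^ 2 ∂(step q s).toMeasure ≤
      q * ((2 * K + 2 * K * E) * ℓ) ^ 2 + (33 + 3 * β) ^ 2 := by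
    rw [integral_step hq0 hq1 s _ (by simp)]
    refine (davg_mono s (G := fun _ => q * ((2 * K + 2 * K * E) * ℓ) ^ 2 + (33 + 3 * β) ^ 2)
      fun e he => ?_).trans (davg_const s h _).le
    obtain ⟨hadj, hop⟩ := mem_discordant.1 he
    refine add_le_add (mul_le_mul_of_nonneg_left ?_ hq0) ?_
    · exact sq_le_sq' (abs_le.1 (abs_potential_imitate_le hT hL hop)).1
        (abs_le.1 (abs_potential_imitate_le hT hL hop)).2
    · have h2 : tavg s e.1 (fun z => ((s.moveEdge e.1 e.2 z).potential ν K E β η ℓ -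
          s.potential ν K E β η ℓ) ^ 2) ≤ (33 + 3 * β) ^ 2 :=
        tavg_le_of_le s e.1 (sq_nonneg _) fun z hz => by
          have := abs_le.1 (abs_potential_moveEdge_le hT hL hs hadj hop hz)
          exact sq_le_sq' this.1 this.2
      have h3 : 0 ≤ tavg s e.1 (fun z => ((s.moveEdge e.1 e.2 z).potential ν K E β η ℓ -
          s.potential ν K E β η ℓ) ^ 2) := tavg_nonneg s e.1 fun _ _ => sq_nonneg _
      nlinarith
  have h2 : ∫ t, (t.potential ν K E β η ℓ - s.potential ν K E β η ℓ + 9 / 25) ^ 2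
      ∂(step q s).toMeasure ≤
      ∫ t, (2 * (t.potential ν K E β η ℓ - s.potential ν K E β η ℓ) ^ 2 + 1)
        ∂(step q s).toMeasure :=
    integral_mono .of_finite .of_finite fun t => by
      have := sq_nonneg (t.potential ν K E β η ℓ - s.potential ν K E β η ℓ - 9 / 25)
      simp only
      nlinarith
  rw [integral_add .of_finite .of_finite, integral_const_mul] at h2
  simp only [integral_const, probReal_univ, one_smul] at h2
  have h3 : q * ((2 * K + 2 * K * E) * ℓ) ^ 2 = ν * (2 * K + 2 * K * E) ^ 2 * ℓ := by
    rw [← hqℓ]; ring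
  have h4 : (33 + 3 * β) ^ 2 ≤ (33 + 3 * β) ^ 2 * ℓ := le_mul_of_one_le_right (sq_nonneg _) hℓ
  rw [h3] at h1
  unfold varianceBound
  linarith

/-! ### Fluctuations of the number of ones; conservation of edges -/

/-- The number of vertices in state `1` is a martingale with small variance. -/
lemma integral_ones_sq_le {q : ℝ} (hq0 : 0 ≤ q) (hq1 : q ≤ 1) (s : Config N) (c : ℝ) :
    ∫ t, ((t.ones : ℝ) - c) ^ 2 ∂(step q s).toMeasure ≤ ((s.ones : ℝ) - c) ^ 2 + q := by
  have h1 : ∫ t, ((t.ones : ℝ) - c) ^ 2 ∂(step q s).toMeasure = ((s.ones : ℝ) - c) ^ 2 +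
      ∫ t, (((t.ones : ℝ) - c) ^ 2 - ((s.ones : ℝ) - c) ^ 2) ∂(step q s).toMeasure := by
    rw [integral_sub .of_finite .of_finite]; simp
  rw [h1, integral_step hq0 hq1 s _ (sub_self _)]
  refine add_le_add_right ?_ _
  rcases s.discordant.eq_empty_or_nonempty with h | h
  · simpa [davg, h] using hq0
  set F : Fin N × Fin N → ℝ := fun e => if s.opinion e.1 = true then -1 else 1
  have hF : davg s F = 0 := by
    have h2 := davg_swap s F
    have h3 : davg s (fun e => F e.swap) = davg s (fun e => (-1) * F e) := by
      have : ∀ e ∈ s.discordant, F e.swap = (-1) * F e := fun e he => by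
        have := (mem_discordant.1 he).2
        simp only [F, Prod.fst_swap]
        split_ifs <;> simp_all
      exact le_antisymm (davg_mono s fun e he => (this e he).le)
        (davg_mono s fun e he => (this e he).ge)
    rw [h3, davg_const_mul] at h2
    linarith
  have h4 := davg_mono s (F := fun e => q * (((s.imitate e.1 e.2).ones - c : ℝ) ^ 2 -
      ((s.ones : ℝ) - c) ^ 2) + (1 - q) * tavg s e.1 fun z =>
        (((s.moveEdge e.1 e.2 z).ones - c : ℝ) ^ 2 - ((s.ones : ℝ) - c) ^ 2))
    (G := fun e => 2 * q * ((s.ones : ℝ) - c) * F e + q) fun e he => ?_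
  · refine h4.trans (le_of_eq ?_)
    rw [davg_add, davg_const_mul, davg_const s h, hF]
    ring
  · have h5 := ones_imitate (mem_discordant.1 he).2
    have h6 : tavg s e.1 (fun z =>
        (((s.moveEdge e.1 e.2 z).ones - c : ℝ) ^ 2 - ((s.ones : ℝ) - c) ^ 2)) = 0 := by
      simp [ones_moveEdge, tavg]
    rw [h6, mul_zero, add_zero]
    have h7 : ((s.imitate e.1 e.2).ones : ℝ) = s.ones + F e := by simp only [F]; linarith
    have h8 : F e ^ 2 = 1 := by simp only [F]; split_ifs <;> norm_num
    rw [h7]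
    refine le_of_eq ?_
    linear_combination q * h8

open Classical in
/-- The number of edges does not change. -/
lemma integral_totalDeg_ne {q : ℝ} (hq0 : 0 ≤ q) (hq1 : q ≤ 1) (s : Config N) (m : ℕ)
    (hs : s.totalDeg = m) :
    ∫ t : Config N, (if t.totalDeg = m then (0 : ℝ) else 1) ∂(step q s).toMeasure = 0 := by
  rw [integral_step hq0 hq1 s _ (by simp [hs])]
  unfold davg
  rw [Finset.sum_eq_zero, zero_div]
  intro e he
  have hadj := (mem_discordant.1 he).1
  unfold tavg
  rw [Finset.sum_eq_zero (s := s.targets e.1) fun z hz => by simp [totalDeg_moveEdge hadj hz, hs]]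
  simp [totalDeg_imitate, hs]

end Config

/-! ### Choice of constants and large `N` -/

lemma exists_tuned {ν : ℝ} (hν : 0 < ν) : ∃ K E β η ρ : ℝ, Tuned ν K E β η ρ := by
  -- The order is `K`, `E`, `β`, `η`, `ρ`. The edge drift uses the fixed hub threshold `1/480`, so
  -- `K` is absolute (`20 * 480 / K = 1/20`). A single threshold would be circular, since `η` must
  -- be small against `1 / β` and `β` grows with `K`.
  set K : ℝ := 192000 with hK
  set E := Real.exp (4 * K * ν) with hE
  have hE0 : 0 < E := Real.exp_pos _
  have hK0 : 0 < K := by norm_num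
  set β := 16 * K * ν * E with hβ
  have hβ0 : 0 < β := by positivity
  set η := min (1 / 8) (1 / (40 * β)) with hη
  have hη0 : 0 < η := by positivity
  set ρ := min (1 / 48000) (min (2 * η / (25 * β)) (1 / (20 * K * E))) with hρ
  have hρ0 : 0 < ρ := by positivity
  refine ⟨K, E, β, η, ρ, hν, hK, hE, hβ, hη0, min_le_left _ _, ?_, hρ0, ?_, ?_, ?_⟩
  · have h : η ≤ 1 / (40 * β) := min_le_right _ _
    rw [le_div_iff₀ (by positivity)] at h
    linarith
  · have h : ρ ≤ 1 / 48000 := min_le_left _ _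
    linarith
  · have h : ρ ≤ 2 * η / (25 * β) := (min_le_right _ _).trans (min_le_left _ _)
    rw [le_div_iff₀ (by positivity)] at h
    rw [div_le_iff₀ (by positivity)]
    linarith
  · have h : ρ ≤ 1 / (20 * K * E) := (min_le_right _ _).trans (min_le_right _ _)
    rw [le_div_iff₀ (by positivity)] at h
    linarith

/-- Every condition follows from `N → ∞`, `L → ∞` and `L / N → 0`; the exponent `a` in `(0, 1)`
serves only to give the last two. -/
lemma eventually_large {ν β η a : ℝ} (hη : 0 < η) (ha0 : 0 < a) (ha1 : a < 1)
    {L : ℕ → ℝ} (hL : Asymptotics.IsEquivalent atTop L (fun N : ℕ => (N : ℝ) ^ a)) :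
    ∀ᶠ N : ℕ in atTop, Large N ν β η (L N) := by
  have hN : Tendsto (fun N : ℕ => (N : ℝ)) atTop atTop := tendsto_natCast_atTop_atTop
  have hLt : Tendsto L atTop atTop :=
    hL.symm.tendsto_atTop ((tendsto_rpow_atTop ha0).comp hN)
  have hlit : (fun N : ℕ => (N : ℝ) ^ a) =o[atTop] (fun N : ℕ => (N : ℝ)) := by
    have h : Tendsto (fun N : ℕ => (N : ℝ) ^ (-(1 - a))) atTop (nhds 0) :=
      (tendsto_rpow_neg_atTop (by linarith)).comp hN
    refine (Asymptotics.isLittleO_iff_tendsto' ?_).2 (h.congr' ?_)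
    · filter_upwards [eventually_gt_atTop 0] with N hN h0
      exact absurd h0 (by positivity)
    · filter_upwards [eventually_gt_atTop 0] with N hN
      have : (0 : ℝ) < N := by exact_mod_cast hN
      rw [neg_sub, Real.rpow_sub_one this.ne']
  have hr : Tendsto (fun N : ℕ => L N / N) atTop (nhds 0) :=
    (hL.isBigO.trans_isLittleO hlit).tendsto_div_nhds_zero
  have h1 : Tendsto (fun N : ℕ => ν / L N) atTop (nhds 0) := hLt.const_div_atTop ν
  have h2 : Tendsto (fun N : ℕ => 12 * (13 * 480) * (L N / N) + β * 13 / η * (L N / N)) atTop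
      (nhds 0) := by
    simpa using (hr.const_mul (12 * (13 * 480))).add (hr.const_mul (β * 13 / η))
  have h3 : Tendsto (fun N : ℕ => (12 + β) * 2 * (L N / N)) atTop (nhds 0) := by
    simpa using hr.const_mul ((12 + β) * 2)
  have h4 : Tendsto (fun N : ℕ => 5 * 480 * (L N / N)) atTop (nhds 0) := by
    simpa using hr.const_mul (5 * 480)
  have h5 : Tendsto (fun N : ℕ => 5 / η * (L N / N)) atTop (nhds 0) := by
    simpa using hr.const_mul (5 / η)
  filter_upwards [hLt.eventually_ge_atTop 1, h1.eventually_le_const (show (0 : ℝ) < 1 / 20 by norm_num),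
    hN.eventually_ge_atTop 960, hN.eventually_ge_atTop (2 / η),
    h2.eventually_le_const (show (0 : ℝ) < 1 / 100 by norm_num),
    h3.eventually_le_const (show (0 : ℝ) < 1 / 100 by norm_num),
    h4.eventually_le_const (show (0 : ℝ) < 1 by norm_num),
    h5.eventually_le_const (show (0 : ℝ) < 1 by norm_num)] with N g1 g2 g3 g4 g5 g6 g7 g8
  have hN0 : (0 : ℝ) < N := by linarith
  refine ⟨g1, g2, by linarith, ?_, ?_, ?_, ?_, ?_⟩
  · rw [div_le_iff₀ hη] at g4; linarith
  · refine le_trans (le_of_eq ?_) g5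
    field_simp
  · have : (12 + β) * (2 * L N) = (12 + β) * 2 * (L N / N) * N := by field_simp
    rw [this]
    exact mul_le_mul_of_nonneg_right g6 hN0.le
  · refine le_trans (le_of_eq ?_) g7
    field_simp
  · refine le_trans (le_of_eq ?_) g8
    field_simp

/-! ### Absorption with high probability -/

open Config in
/-- From a configuration with few vertices in state `1`, absorption happens within `n` updates
while the fraction of ones stays near its initial value, except with small probability. -/
lemma law_absorbed_ge {N : ℕ} {ν K E β η ρ ℓ p ε : ℝ} (hT : Tuned ν K E β η ρ)
    (hL : Large N ν β η ℓ) (hp : p ≤ ρ / 2) (hε : 0 < ε) (hε' : ε ≤ ρ / 2)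
    {s₀ : Config N} (hs₀ : (s₀.totalDeg : ℝ) = N * ℓ) (hones : (s₀.ones : ℝ) = p * N)
    {n : ℕ} (hn1 : 6 * (N * ℓ) ≤ n) (hn2 : (n : ℝ) ≤ 7 * (N * ℓ)) :
    1 - (7 * ν / ε ^ 2 / N + 60 * varianceBound ν K E β / N) ≤ (law ν ℓ s₀).real
      {X | ∃ t ≤ n, IsTau X t ∧ |((X t).ones : ℝ) - p * N| < ε * N} := by
  classical
  set μ := law ν ℓ s₀
  have hμ := isChain_law ν ℓ s₀
  have h0 := law_zero ν ℓ s₀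
  have hℓ := hL.hℓ
  have hq := hL.hq
  have hN : (0 : ℝ) < N := by linarith [hL.hN1]
  have hν := hT.hν
  have hq0 : 0 ≤ ν / ℓ := by positivity
  have hV0 : 0 ≤ varianceBound ν K E β := by unfold varianceBound; positivity
  set A : Set (Config N) :=
    {s | s.discordant.Nonempty ∧ s.totalDeg = s₀.totalDeg ∧ (s.ones : ℝ) ≤ ρ * N}
  have b1 := hμ.maximal h0 (fun s => ((s.ones : ℝ) - p * N) ^ 2) (fun s => sq_nonneg _)
    (V := ν / ℓ) (r := (ε * N) ^ 2) hq0 (by positivity)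
    (fun s _ => integral_ones_sq_le hq0 (by linarith) s _) n
  -- With `V = 0` and initial value `0`, the maximal inequality says that the number of edges is
  -- almost surely conserved up to time `n`.
  have b2 := hμ.maximal h0 (fun s => if s.totalDeg = s₀.totalDeg then (0 : ℝ) else 1)
    (fun s => by split_ifs <;> norm_num) (V := 0) (r := 1) le_rfl one_pos
    (fun s hs => by
      have hs' : s.totalDeg = s₀.totalDeg := by by_contra hc; simp [hc] at hs
      rw [integral_totalDeg_ne hq0 (by linarith) s _ hs']
      simp [hs']) n
  have hA : ∀ s ∈ A, (s.totalDeg : ℝ) = N * ℓ := fun s hs => by rw [hs.2.1, hs₀]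
  have b3 := hμ.stays_le h0 A (fun s => s.potential ν K E β η ℓ) (c := 9 / 25)
    (V := varianceBound ν K E β * ℓ) (B := 181 / 100 * (N * ℓ)) (by positivity)
    (fun s hs => integral_potential_le hT hL (hA s hs) hs.2.2 hs.1)
    (fun s hs => integral_potential_sq_le hT hL (hA s hs) hs.1)
    (fun s hs => potential_sub_le hT hL hs₀ (hA s hs) hs.2.2) n
    (by have : 0 < N * ℓ := by positivity
        linarith)
  set B1 : Set (ℕ → Config N) := {X | ∃ m ≤ n, (ε * N) ^ 2 ≤ (((X m).ones : ℝ) - p * N) ^ 2}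
  set B2 : Set (ℕ → Config N) :=
    {X | ∃ m ≤ n, 1 ≤ if (X m).totalDeg = s₀.totalDeg then (0 : ℝ) else 1}
  set B3 : Set (ℕ → Config N) := {X | ∀ m ≤ n, X m ∈ A}
  set G : Set (ℕ → Config N) := {X | ∃ t ≤ n, IsTau X t ∧ |((X t).ones : ℝ) - p * N| < ε * N}
  -- Off `B1` and `B2` the ones stay below `(p + ε) N ≤ ρ N` and the edge count is constant, so `A`
  -- can be left only by absorption.
  have hcover : (Set.univ : Set (ℕ → Config N)) ⊆ ((G ∪ B1) ∪ B2) ∪ B3 := by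
    intro X _
    by_cases hB1 : X ∈ B1
    · exact Or.inl (Or.inl (Or.inr hB1))
    by_cases hB2 : X ∈ B2
    · exact Or.inl (Or.inr hB2)
    by_cases hB3 : X ∈ B3
    · exact Or.inr hB3
    refine Or.inl (Or.inl (Or.inl ?_))
    have k1 : ∀ m ≤ n, |((X m).ones : ℝ) - p * N| < ε * N := fun m hm => by
      by_contra hc
      refine hB1 ⟨m, hm, ?_⟩
      rw [← sq_abs (((X m).ones : ℝ) - p * N)]
      exact pow_le_pow_left₀ (by positivity) (not_lt.1 hc) 2
    have k2 : ∀ m ≤ n, (X m).totalDeg = s₀.totalDeg := fun m hm => by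
      by_contra hc
      exact hB2 ⟨m, hm, by simp [hc]⟩
    have k3 : ∃ m, (X m).discordant = ∅ ∧ m ≤ n := by
      by_contra hc
      refine hB3 fun m hm => ⟨?_, k2 m hm, ?_⟩
      · by_contra hd
        exact hc ⟨m, Finset.not_nonempty_iff_eq_empty.1 hd, hm⟩
      · have := (abs_lt.1 (k1 m hm)).2
        have := mul_le_mul_of_nonneg_right hp hN.le
        have := mul_le_mul_of_nonneg_right hε' hN.le
        linarith
    obtain ⟨m, hm, hmn⟩ := k3
    have hex : ∃ m, (X m).discordant = ∅ := ⟨m, hm⟩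
    have hfn : Nat.find hex ≤ n := (Nat.find_min' hex hm).trans hmn
    exact ⟨Nat.find hex, hfn, ⟨Nat.find_spec hex, fun k hk => Nat.find_min' hex hk⟩, k1 _ hfn⟩
  have htot : 1 ≤ μ.real G + μ.real B1 + μ.real B2 + μ.real B3 := by
    have e1 : (1 : ℝ) = μ.real Set.univ := by simp [μ]
    rw [e1]
    refine (measureReal_mono hcover).trans ((measureReal_union_le _ _).trans ?_)
    refine add_le_add_left ((measureReal_union_le _ _).trans ?_) _
    exact add_le_add_left (measureReal_union_le _ _) _
  have hNℓ : 0 < N * ℓ := by positivity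
  have c1 : μ.real B1 ≤ 7 * ν / ε ^ 2 / N := by
    refine b1.trans ?_
    simp only [hones, sub_self]
    rw [div_div, div_le_div_iff₀ (by positivity) (by positivity)]
    have h1 : n * (ν / ℓ) ≤ 7 * (N * ℓ) * (ν / ℓ) := mul_le_mul_of_nonneg_right hn2 hq0
    have h2 : 7 * (N * ℓ) * (ν / ℓ) = 7 * N * ν := by field_simp
    have h3 : 0 ≤ ε ^ 2 * N := by positivity
    calc (0 ^ 2 + n * (ν / ℓ)) * (ε ^ 2 * N) ≤ 7 * N * ν * (ε ^ 2 * N) :=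
          mul_le_mul_of_nonneg_right (by linarith) h3
      _ = _ := by ring
  have c2 : μ.real B2 ≤ 0 := b2.trans (by simp)
  have c3 : μ.real B3 ≤ 60 * varianceBound ν K E β / N := by
    refine b3.trans ?_
    -- `6 * 9/25 - 181/100 = 7/20`: the drift accumulated over `6 N ℓ` updates exceeds the available
    -- range.
    have h1 : 7 / 20 * (N * ℓ) ≤ 9 / 25 * n - 181 / 100 * (N * ℓ) := by linarith
    calc n * (varianceBound ν K E β * ℓ) / (9 / 25 * n - 181 / 100 * (N * ℓ)) ^ 2
        ≤ 7 * (N * ℓ) * (varianceBound ν K E β * ℓ) / (7 / 20 * (N * ℓ)) ^ 2 := by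
          gcongr
      _ = (400 / 7) * varianceBound ν K E β / N := by field_simp; ring
      _ ≤ _ := by gcongr; norm_num
  linarith

end EvolvingVoter

theorem theorem6 (ν : ℝ) (hν : 0 < ν) :
    ∃ pν : ℝ, 0 < pν ∧ pν < 1 / 2 ∧
      ∀ ε : ℝ, 0 < ε →
      ∀ a : ℝ, 0 < a → a < 1 →
      ∀ L : ℕ → ℝ, Asymptotics.IsEquivalent atTop L (fun N : ℕ => (N : ℝ) ^ a) →
      ∀ δ : ℝ, 0 < δ → ∀ᶠ N : ℕ in atTop,
        ∀ p : ℝ, p ≤ pν → ∀ G₀ ∈ EvolvingVoter.labeledGraphs p N (L N),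
          1 - δ ≤ (EvolvingVoter.law ν (L N) G₀).real
            {X | ∃ t : ℕ, EvolvingVoter.IsTau X t ∧ (t : ℝ) < 7 * N * L N ∧
              (X t).fractionOnes ∈ Set.Ioo (p - ε) (p + ε)} := by
  obtain ⟨K, E, β, η, ρ, hT⟩ := EvolvingVoter.exists_tuned hν
  have hρ0 := hT.hρ0
  have hρ1 := hT.hρ1
  refine ⟨ρ / 2, by linarith, by linarith, fun ε hε a ha0 ha1 L hL δ hδ => ?_⟩
  -- Shrinking `ε` keeps `p + ε'` at most `ρ`, where the drift estimate holds.
  set ε' := min ε (ρ / 2)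
  have hε0 : 0 < ε' := lt_min hε (by linarith)
  have hlim : Tendsto (fun N : ℕ => 7 * ν / ε' ^ 2 / (N : ℝ) +
      60 * EvolvingVoter.Config.varianceBound ν K E β / N) atTop (nhds 0) := by
    simpa using (tendsto_const_div_atTop_nhds_zero_nat (7 * ν / ε' ^ 2)).add
      (tendsto_const_div_atTop_nhds_zero_nat (60 * EvolvingVoter.Config.varianceBound ν K E β))
  filter_upwards [EvolvingVoter.eventually_large (ν := ν) (β := β) hT.hη0 ha0 ha1 hL,
    hlim.eventually_le_const hδ] with N hLarge hprob p hp G₀ hG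
  have hℓ := hLarge.hℓ
  have hN : (0 : ℝ) < N := by linarith [hLarge.hN1]
  obtain ⟨hG1, hG2⟩ := hG
  have hdeg : (G₀.totalDeg : ℝ) = N * L N := by
    rw [EvolvingVoter.Config.totalDeg_eq]; push_cast; linarith
  rw [EvolvingVoter.Config.ncard_ones] at hG2
  have hNℓ : 2 ≤ N * L N := by nlinarith [hLarge.hN1]
  -- Rounding down loses less than `1 ≤ N L / 2`, so `n` is at least `6 N L` and strictly below `7 N
  -- L`.
  set n := ⌊13 / 2 * (N * L N)⌋₊
  have hn1 : (n : ℝ) ≤ 13 / 2 * (N * L N) := Nat.floor_le (by linarith)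
  have hn2 : 13 / 2 * (N * L N) < n + 1 := Nat.lt_floor_add_one _
  have main := EvolvingVoter.law_absorbed_ge hT hLarge hp hε0 (min_le_right _ _) hdeg hG2
    (n := n) (by linarith) (by linarith)
  refine le_trans (by linarith) (main.trans (measureReal_mono ?_))
  rintro X ⟨t, htn, htau, hX⟩
  refine ⟨t, htau, ?_, ?_⟩
  · have : (t : ℝ) ≤ n := by exact_mod_cast htn
    linarith
  · have hle : ε' * N ≤ ε * N := mul_le_mul_of_nonneg_right (min_le_left _ _) hN.le
    obtain ⟨h1, h2⟩ := abs_lt.1 hX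
    rw [EvolvingVoter.Config.fractionOnes, EvolvingVoter.Config.ncard_ones, Set.mem_Ioo,
      lt_div_iff₀ hN, div_lt_iff₀ hN]
    constructor <;> linarith
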